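/- Let $r\ge 1$ and let $Z=(X,Y)$ be a piecewise smooth system on a bounded open neighbourhood $\mathcal U\subset\mathbb R^2$ of the origin: $X=(X_1,X_2)$ and $Y=(Y_1,Y_2)$ are $C^r$ vector fields on $\mathcal U$, with $Z=X$ on $\mathcal U^+=\{x_1x_2>0\}$ and $Z=Y$ on $\mathcal U^-=\{x_1x_2<0\}$. The switching set is $\Sigma=\{x_1x_2=0\}=\Sigma_1\cup\Sigma_2$ with $\Sigma_i=\{x_i=0\}$. On $\Sigma\setminus\{0\}$ Filippov's convention holds. Points of $\Sigma_i$ with $X_iY_i>0$ are crossing points, where trajectories in $\mathcal U^+$ and $\mathcal U^-$ are concatenated. At points of $\Sigma_i\setminus\{0\}$ with $X_iY_i<0$ (sliding or escaping points) the trajectory is that of the sliding vector field $Z_i^s=\frac{Y_iX_j-X_iY_j}{Y_i-X_i}$ on $\Sigma_i$ ($j\ne i$), and trajectories of $X$ and $Y$ that end at such points do not contain them. If, near the origin, one branch $\Sigma_i$ consists of sliding and escaping points outside the origin and the other one of crossing points, then the trajectory of the origin is that of $Z_i^s$. Two such systems $Z,\tilde Z$ are *locally $\Sigma$-equivalent*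 if there are neighbourhoods $\mathcal U_0,\tilde{\mathcal U}_0$ of the origin and an orientation preserving homeomorphism $h:\mathcal U_0\to\tilde{\mathcal U}_0$ that sends $\Sigma\cap\mathcal U_0$ onto $\tilde\Sigma\cap\tilde{\mathcal U}_0$ and maps the trajectories of $Z$ in $\mathcal U_0$ onto those of $\tilde Z$ in $\tilde{\mathcal U}_0$, preserving the direction of time. Suppose that $X_iY_i(0)>0$ and $X_jY_j(0)<0$ for some $\{i,j\}=\{1,2\}$, that $X_1X_2(0)<0$, and that $$\alpha_Z=\frac{X_1(0)\,Y_2(0)}{X_2(0)\,Y_1(0)}\neq-1 .$$ Then $Z$ is locally $\Sigma$-equivalent to the piecewise constant system $$\tilde Z(p)=\begin{cases}(a,-a), & p\in\mathcal U^+,\\ \bigl(b(1+\delta_{1c}),\,b(1+\delta_{-1c})\bigr), & p\in\mathcal U^-,\end{cases}$$ where $a=\operatorname{sgn}X_1(0)$, $b=\operatorname{sgn}Y_1(0)$, $c=\operatorname{sgn}(\alpha_Z+1)$ and $\delta$ is the Kronecker symbol. -/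

import Mathlib

open Set Filter Topology

/-- The plane; the coordinates `x₁`, `x₂` are `p 0`, `p 1`. -/
abbrev Plane : Type := Fin 2 → ℝ

/-- The index different from `i`. -/
def otherIdx (i : Fin 2) : Fin 2 := 1 - i

/-- A piecewise smooth system `Z = (X, Y)` of class `C^r` on a bounded open neighbourhood `U` of the
origin: `X` acts where `x₁ x₂ > 0` and `Y` acts where `x₁ x₂ < 0`. -/
structure PWSystem (r : WithTop ℕ∞) where
  U : Set Plane
  isOpen_U : IsOpen U
  isBounded_U : Bornology.IsBounded U
  zero_mem_U : (0 : Plane) ∈ U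
  X : Plane → Plane
  Y : Plane → Plane
  contDiffOn_X : ContDiffOn ℝ r X U
  contDiffOn_Y : ContDiffOn ℝ r Y U

namespace PWSystem

variable {r : WithTop ℕ∞} (Z : PWSystem r)

/-! ### Regions -/

/-- The open region `U⁺`. -/
def Upos : Set Plane := {p | p ∈ Z.U ∧ 0 < p 0 * p 1}

/-- The open region `U⁻`. -/
def Uneg : Set Plane := {p | p ∈ Z.U ∧ p 0 * p 1 < 0}

/-- The switching set `Σ`. -/
def switching : Set Plane := {p | p ∈ Z.U ∧ p 0 * p 1 = 0}

/-- The branch `Σ_i` of the switching set. -/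
def branch (i : Fin 2) : Set Plane := {p | p ∈ Z.U ∧ p i = 0}

/-- The crossing region `Σ_i^c`. -/
def crossing (i : Fin 2) : Set Plane := {p | p ∈ Z.branch i ∧ 0 < Z.X p i * Z.Y p i}

/-- The sliding region `Σ_i^s`. -/
def sliding (i : Fin 2) : Set Plane :=
  {p | p ∈ Z.branch i ∧ ((0 < p (otherIdx i) ∧ Z.X p i < 0 ∧ 0 < Z.Y p i) ∨
    (p (otherIdx i) < 0 ∧ 0 < Z.X p i ∧ Z.Y p i < 0))}

/-- The escaping region `Σ_i^e`. -/
def escaping (i : Fin 2) : Set Plane :=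
  {p | p ∈ Z.branch i ∧ ((0 < p (otherIdx i) ∧ 0 < Z.X p i ∧ Z.Y p i < 0) ∨
    (p (otherIdx i) < 0 ∧ Z.X p i < 0 ∧ 0 < Z.Y p i))}

/-- `Σ_i^s ∪ Σ_i^e`. -/
def slideEscape (i : Fin 2) : Set Plane := Z.sliding i ∪ Z.escaping i

/-- The sliding vector field `Z_i^s`: with `j ≠ i`, the velocity of the coordinate `x_j` along the
line `x_i = 0`. -/
noncomputable def slidingField (i : Fin 2) (p : Plane) : ℝ :=
  (Z.Y p i * Z.X p (otherIdx i) - Z.X p i * Z.Y p (otherIdx i)) / (Z.Y p i - Z.X p i)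

/-! ### Trajectories -/

/-- Near the time `t` the curve `γ` stays on `Σ_i`, and at `t` it follows `Z_i^s`. -/
def SlidesAt (i : Fin 2) (γ : ℝ → Plane) (t : ℝ) : Prop :=
  (∀ᶠ s in 𝓝 t, γ s ∈ Z.branch i) ∧
    HasDerivAt (fun s => γ s (otherIdx i)) (Z.slidingField i (γ t)) t

/-- The curve `γ` obeys `Z` at the time `t`, at which it is in `U⁺`, in `U⁻`, at a crossing point
other than the origin (where a trajectory in `U⁺` and one in `U⁻` are concatenated) or at a sliding
or escaping point (where it follows the sliding vector field). -/
def RegularAt (γ : ℝ → Plane) (t : ℝ) : Prop :=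
  (γ t ∈ Z.Upos ∧ HasDerivAt γ (Z.X (γ t)) t) ∨
  (γ t ∈ Z.Uneg ∧ HasDerivAt γ (Z.Y (γ t)) t) ∨
  (∃ i, γ t ∈ Z.crossing i ∧ γ t ≠ 0 ∧
    (((∀ᶠ s in 𝓝[<] t, γ s ∈ Z.Upos) ∧ (∀ᶠ s in 𝓝[>] t, γ s ∈ Z.Uneg)) ∨
      ((∀ᶠ s in 𝓝[<] t, γ s ∈ Z.Uneg) ∧ (∀ᶠ s in 𝓝[>] t, γ s ∈ Z.Upos)))) ∨
  (∃ i, γ t ∈ Z.slideEscape i ∧ Z.SlidesAt i γ t)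

/-- A curve that avoids the origin and the tangency points and obeys `Z` on the open interval
`I`. -/
def IsRegularArc (I : Set ℝ) (γ : ℝ → Plane) : Prop :=
  IsOpen I ∧ I.OrdConnected ∧ ContinuousOn γ I ∧ (∀ t ∈ I, γ t ∈ Z.U) ∧
    ∀ t ∈ I, Z.RegularAt γ t

/-- A tangency point on `Σ_i`, outside the origin: it is in none of the crossing, sliding and
escaping regions. -/
def IsTangency (i : Fin 2) (p : Plane) : Prop :=
  p ∈ Z.branch i ∧ p ≠ 0 ∧ Z.X p i * Z.Y p i = 0

/-- Around the time `t` the curve `γ` is the limit of the trajectories through `q ∈ Σ_i` as `q`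
tends to `γ t`, from both sides. -/
def TangencyLimit (i : Fin 2) (γ : ℝ → Plane) (t : ℝ) : Prop :=
  ∃ δ > 0, ∀ ε > 0, ∀ᶠ q in 𝓝[Z.branch i \ {γ t}] (γ t),
    ∃ g, Z.IsRegularArc (Ioo (t - δ) (t + δ)) g ∧ g t = q ∧
      ∀ s ∈ Ioo (t - δ) (t + δ), dist (g s) (γ s) < ε

/-- The tangency point `p` is regular: the trajectories from both sides have a common limit. -/
def IsRegularTangency (i : Fin 2) (p : Plane) : Prop :=
  ∃ γ : ℝ → Plane, γ 0 = p ∧ Z.TangencyLimit i γ 0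

/-- The rule at a tangency point `γ t`. It is the trajectory through a regular tangency point
described by `TangencyLimit`; a singular tangency point is a trajectory by itself. -/
def TangentAt (I : Set ℝ) (γ : ℝ → Plane) (t : ℝ) : Prop :=
  ∃ i, Z.IsTangency i (γ t) ∧
    (Z.TangencyLimit i γ t ∨ (¬ Z.IsRegularTangency i (γ t) ∧ ∀ s ∈ I, γ s = γ t))

/-- Near the origin, `Σ` is the closure of the crossing region. -/
def OriginCrossing : Prop :=
  ∀ᶠ p in 𝓝 (0 : Plane), p ∈ Z.switching → p ∈ closure (Z.crossing 0 ∪ Z.crossing 1)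

/-- Sliding or escaping points of both `Σ_1` and `Σ_2` accumulate at the origin. -/
def OriginDoubleSliding : Prop := ∀ i, (0 : Plane) ∈ closure (Z.slideEscape i)

/-- Sliding or escaping points of `Σ_i`, and crossing points of the other branch, accumulate at the
origin. -/
def OriginSliding (i : Fin 2) : Prop :=
  (0 : Plane) ∈ closure (Z.slideEscape i) ∩ closure (Z.crossing (otherIdx i))

/-- The rule at the origin. If `Σ` is crossing, the trajectory of the origin is the one of `X` or of
`Y` that stays in `U⁺` or in `U⁻`; if one branch is sliding or escaping and the other is crossing,
it is the one of the sliding vector field; otherwise the origin is a trajectory by itself. -/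
def OriginAt (I : Set ℝ) (γ : ℝ → Plane) (t : ℝ) : Prop :=
  γ t = 0 ∧
    ((Z.OriginCrossing ∧
      ((∀ᶠ s in 𝓝 t, γ s ∈ Z.Upos ∪ {0} ∧ HasDerivAt γ (Z.X (γ s)) s) ∨
        (∀ᶠ s in 𝓝 t, γ s ∈ Z.Uneg ∪ {0} ∧ HasDerivAt γ (Z.Y (γ s)) s))) ∨
    (¬ Z.OriginCrossing ∧ ¬ Z.OriginDoubleSliding ∧
      ∃ i, Z.OriginSliding i ∧ Z.SlidesAt i γ t) ∨
    (¬ Z.OriginCrossing ∧ (Z.OriginDoubleSliding ∨ ∀ i, ¬ Z.OriginSliding i) ∧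
      ∀ s ∈ I, γ s = 0))

/-- `γ` restricted to the open interval `I` is an arc of a trajectory of `Z` inside `V`. As the
interval is open and a trajectory that is at a sliding or escaping point stays on `Σ`, trajectories
of `X` and `Y` are relatively open: they do not contain the sliding and escaping points that are
their end points. -/
def IsTrajectory (V : Set Plane) (I : Set ℝ) (γ : ℝ → Plane) : Prop :=
  IsOpen I ∧ I.OrdConnected ∧ I.Nonempty ∧ ContinuousOn γ I ∧ (∀ t ∈ I, γ t ∈ V ∩ Z.U) ∧
    ∀ t ∈ I, Z.RegularAt γ t ∨ Z.TangentAt I γ t ∨ Z.OriginAt I γ t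

end PWSystem

/-! ### Local equivalence -/

/-- `h` has local degree `+1` at `p`: the images of the small positively oriented circles around `p`
wind once, positively, around `h p`. For an injective continuous `h` on a connected open subset of
the plane, this holds at one point if and only if `h` preserves the orientation everywhere. -/
def OrientationPreservingAt (h : Plane → Plane) (p : Plane) : Prop :=
  ∀ᶠ ρ in 𝓝[>] (0 : ℝ), ∃ θ R : ℝ → ℝ,
    ContinuousOn θ (Icc 0 (2 * Real.pi)) ∧ θ (2 * Real.pi) = θ 0 + 2 * Real.pi ∧
      ∀ t ∈ Icc 0 (2 * Real.pi), 0 < R t ∧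
        h (p + ρ • ![Real.cos t, Real.sin t]) - h p =
          R t • ![Real.cos (θ t), Real.sin (θ t)]

/-- `h` sends each arc of trajectory of `Z` in `V` onto an arc of trajectory of `Z'` in `V'`,
preserving the direction of time (`τ` is the change of time). -/
def SendsTrajectories {r : WithTop ℕ∞} (Z Z' : PWSystem r) (V V' : Set Plane)
    (h : Plane → Plane) : Prop :=
  ∀ (I : Set ℝ) (γ : ℝ → Plane), Z.IsTrajectory V I γ →
    ∃ (I' : Set ℝ) (γ' : ℝ → Plane) (τ : ℝ → ℝ), Z'.IsTrajectory V' I' γ' ∧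
      StrictMonoOn τ I ∧ ContinuousOn τ I ∧ τ '' I = I' ∧ ∀ t ∈ I, h (γ t) = γ' (τ t)

/-- Local `Σ`-equivalence: there are connected open neighbourhoods `h.source`, `h.target` of the
origin and an orientation preserving homeomorphism `h` between them which sends `Σ` onto `Σ'` and
the oriented trajectories of `Z` onto those of `Z'`. -/
def LocallySigmaEquivalent {r : WithTop ℕ∞} (Z Z' : PWSystem r) : Prop :=
  ∃ h : OpenPartialHomeomorph Plane Plane,
    h.source ⊆ Z.U ∧ h.target ⊆ Z'.U ∧ (0 : Plane) ∈ h.source ∧ h 0 = 0 ∧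
    IsConnected h.source ∧ OrientationPreservingAt h 0 ∧
    h '' (h.source ∩ Z.switching) = h.target ∩ Z'.switching ∧
    SendsTrajectories Z Z' h.source h.target h ∧
    SendsTrajectories Z' Z h.target h.source h.symm

/-! ### The class `Ω_0^{3,2}` and its normal forms -/

namespace PWSystem

variable {r : WithTop ℕ∞} (Z : PWSystem r)

/-- Condition C3: one branch of `Σ` is crossing, the other is sliding and escaping. -/
def CondC3 : Prop :=
  ∃ i : Fin 2, 0 < Z.X 0 i * Z.Y 0 i ∧ Z.X 0 (otherIdx i) * Z.Y 0 (otherIdx i) < 0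

/-- `α_Z = X_1 Y_2 (0) / (X_2 Y_1 (0))`. -/
noncomputable def alpha : ℝ := (Z.X 0 0 * Z.Y 0 1) / (Z.X 0 1 * Z.Y 0 0)

/-- The class `Ω_0^{3,2}`. -/
def Omega32 : Prop := Z.CondC3 ∧ Z.X 0 0 * Z.X 0 1 < 0 ∧ Z.alpha ≠ -1

end PWSystem

/-- The Kronecker symbol. -/
noncomputable def kronecker (x y : ℝ) : ℝ := if x = y then 1 else 0

/-- The piecewise constant system on the domain `U` of `Z` with `X = (a, -a)` and
`Y = (b (1 + δ_{1c}), b (1 + δ_{-1c}))`, where `a = sgn X_1(0)`, `b = sgn Y_1(0)` and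
`c = sgn (α_Z + 1)`. -/
noncomputable def normalForm {r : WithTop ℕ∞} (Z : PWSystem r) : PWSystem r where
  U := Z.U
  isOpen_U := Z.isOpen_U
  isBounded_U := Z.isBounded_U
  zero_mem_U := Z.zero_mem_U
  X := fun _ => ![Real.sign (Z.X 0 0), -Real.sign (Z.X 0 0)]
  Y := fun _ => ![Real.sign (Z.Y 0 0) * (1 + kronecker 1 (Real.sign (Z.alpha + 1))),
    Real.sign (Z.Y 0 0) * (1 + kronecker (-1) (Real.sign (Z.alpha + 1)))]
  contDiffOn_X := contDiffOn_const
  contDiffOn_Y := contDiffOn_const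

/-!
Near the origin the theorem reduces to a statement about one-dimensional maps.

In the coordinates `(s p_i, s p_j)`, where `Σ_i` is the crossing branch and `s` the sign of
`X_i(0)`, the field `X` points to the right and down, `Y` to the right and up, and the sliding
vector field to the right (`PWSystem.Adapted`). Hence the abscissa increases along all trajectories:
a trajectory either slides along the first axis, or stays in the upper or in the lower half-plane
and crosses the second axis from left to right. After the fields have been extended from a small
square to the whole plane (`FoldModel`, `PWSystem.Adapted.exists_model`), the trajectories in each
half-plane are, up to a change of time, the level sets of a first integral `W`, the ordinate at
which the second axis is met. It comes from the scalar equations `y' = F x y` satisfied by the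
graphs of the trajectories (`SlopeField`, `HalfModel`).

A homeomorphism `(x, y) ↦ (η x, ·)` which maps the level sets of `W` in both half-planes to those of
another model therefore maps trajectories to trajectories. It exists as soon as `η` conjugates, for
both half-planes, the involution of the first axis that exchanges the two points at which a level
set meets the axis: the values of `W` are then changed by maps which are well defined, and `h` is
glued from its restrictions to the half-planes (`FoldModel.exists_matches`).

It remains to conjugate two pairs of involutions of the line (`InvolutionPair.exists_conj`). The
composition of the involutions of a pair is, on a half-line, an increasing homeomorphism with
multiplier `α_Z ^ 2` or `α_Z ^ (-2)` at the origin. As `α_Z ≠ -1`, one of the fields is steeper than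
the other, so that this homeomorphism moves all points in the same direction and is conjugate to a
translation (`OrderIso.exists_abel`); the conjugacy is carried to the other half-line by one of the
involutions. The normal form has the same steeper field as `Z` (`PWSystem.Adapted.normalForm`).
-/

/-! ### Scalar slope fields and their first integrals -/

/-- The right-hand side of a scalar equation `y' = F x y` on the whole plane: continuous, bounded,
and Lipschitz in `y`, so that all solutions are unique and global. -/
structure SlopeField where
  toFun : ℝ → ℝ → ℝ
  continuous_toFun : Continuous (fun p : ℝ × ℝ => toFun p.1 p.2)
  K : NNReal
  lipschitz : ∀ x, LipschitzWith K (toFun x)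
  M : NNReal
  bound : ∀ x y, |toFun x y| ≤ M

namespace SlopeField

instance : CoeFun SlopeField (fun _ => ℝ → ℝ → ℝ) := ⟨SlopeField.toFun⟩

variable (F : SlopeField)

/-- `g` is a global solution of `y' = F x y`. -/
def IsSol (g : ℝ → ℝ) : Prop := ∀ x, HasDerivAt g (F x (g x)) x

theorem IsSol.eq {F : SlopeField} {g₁ g₂ : ℝ → ℝ} (h₁ : F.IsSol g₁) (h₂ : F.IsSol g₂) {x₀ : ℝ}
    (h : g₁ x₀ = g₂ x₀) : g₁ = g₂ :=
  ODE_solution_unique_univ (v := F.toFun) (s := fun _ => univ) (K := F.K)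
    (fun t => (F.lipschitz t).lipschitzOnWith) (fun t => ⟨h₁ t, mem_univ _⟩)
    (fun t => ⟨h₂ t, mem_univ _⟩) h

theorem exists_sol_Icc (x₀ y₀ : ℝ) (n : ℕ) : ∃ g : ℝ → ℝ, g x₀ = y₀ ∧
    ∀ x ∈ Ioo (x₀ - n) (x₀ + n), HasDerivAt g (F x (g x)) x := by
  have hn : (0 : ℝ) ≤ n := n.cast_nonneg
  have hP : IsPicardLindelof F.toFun (tmin := x₀ - n) (tmax := x₀ + n)
      ⟨x₀, by constructor <;> linarith⟩ y₀ (F.M * n) 0 F.M F.K := by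
    refine ⟨fun t _ => (F.lipschitz t).lipschitzOnWith, fun y _ => ?_, fun t _ y _ => F.bound t y,
      ?_⟩
    · exact (F.continuous_toFun.comp (by fun_prop : Continuous fun x : ℝ => (x, y))).continuousOn
    · simp
  obtain ⟨g, hg, hg'⟩ := hP.exists_eq_forall_mem_Icc_hasDerivWithinAt₀
  exact ⟨g, hg, fun x hx => (hg' x (Ioo_subset_Icc_self hx)).hasDerivAt (Icc_mem_nhds hx.1 hx.2)⟩

theorem exists_sol (x₀ y₀ : ℝ) : ∃ g : ℝ → ℝ, g x₀ = y₀ ∧ F.IsSol g := by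
  choose g hg hg' using F.exists_sol_Icc x₀ y₀
  have key : ∀ m n : ℕ, m ≤ n → ∀ x ∈ Ioo (x₀ - m) (x₀ + m), g m x = g n x := by
    intro m n hmn x hx
    have hmn' : (m : ℝ) ≤ n := by exact_mod_cast hmn
    have hx0 : x₀ ∈ Ioo (x₀ - m) (x₀ + m) := by
      have : (0 : ℝ) < m := by linarith [hx.1, hx.2]
      constructor <;> linarith
    exact ODE_solution_unique_of_mem_Ioo (v := F.toFun) (s := fun _ => univ) (K := F.K)
      (fun t _ => (F.lipschitz t).lipschitzOnWith) hx0
      (fun t ht => ⟨hg' m t ht, mem_univ _⟩)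
      (fun t ht => ⟨hg' n t ⟨by linarith [ht.1], by linarith [ht.2]⟩, mem_univ _⟩)
      ((hg m).trans (hg n).symm) hx
  have hN : ∀ x : ℝ, x ∈ Ioo (x₀ - (⌈|x - x₀|⌉₊ + 1 : ℕ)) (x₀ + (⌈|x - x₀|⌉₊ + 1 : ℕ)) := by
    intro x
    have h1 := Nat.le_ceil |x - x₀|
    have h2 := abs_le.1 h1
    push_cast
    constructor <;> linarith [h2.1, h2.2]
  refine ⟨fun x => g (⌈|x - x₀|⌉₊ + 1) x, hg _, fun x => ?_⟩
  set N := ⌈|x - x₀|⌉₊ + 1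
  refine (hg' N x (hN x)).congr_of_eventuallyEq ?_
  filter_upwards [Ioo_mem_nhds (hN x).1 (hN x).2] with z hz
  rcases le_total N (⌈|z - x₀|⌉₊ + 1) with h | h
  · exact (key _ _ h z hz).symm
  · exact key _ _ h z (hN z)

/-- The solution through `(x₀, y₀)`. -/
noncomputable def sol (x₀ y₀ : ℝ) : ℝ → ℝ := (F.exists_sol x₀ y₀).choose

@[simp] theorem sol_self (x₀ y₀ : ℝ) : F.sol x₀ y₀ x₀ = y₀ := (F.exists_sol x₀ y₀).choose_spec.1

theorem isSol_sol (x₀ y₀ : ℝ) : F.IsSol (F.sol x₀ y₀) := (F.exists_sol x₀ y₀).choose_spec.2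

theorem IsSol.sol_eq {F : SlopeField} {g : ℝ → ℝ} (h : F.IsSol g) (x₀ : ℝ) :
    F.sol x₀ (g x₀) = g :=
  (F.isSol_sol _ _).eq h (x₀ := x₀) (by simp)

@[simp] theorem sol_sol (x₀ y₀ x₁ : ℝ) : F.sol x₁ (F.sol x₀ y₀ x₁) = F.sol x₀ y₀ :=
  (F.isSol_sol x₀ y₀).sol_eq x₁

theorem IsSol.continuous {F : SlopeField} {g : ℝ → ℝ} (h : F.IsSol g) : Continuous g :=
  continuous_iff_continuousAt.2 fun x => (h x).continuousAt

theorem strictMono_sol (x₀ x : ℝ) : StrictMono fun y => F.sol x₀ y x := by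
  intro y₁ y₂ h
  by_contra hle
  have hle : F.sol x₀ y₂ x ≤ F.sol x₀ y₁ x := not_lt.1 hle
  -- otherwise the two solutions would meet between `x₀` and `x`
  have hc : Continuous fun z => F.sol x₀ y₂ z - F.sol x₀ y₁ z :=
    (F.isSol_sol _ _).continuous.sub (F.isSol_sol _ _).continuous
  obtain ⟨z, hz⟩ : (0 : ℝ) ∈ range fun z => F.sol x₀ y₂ z - F.sol x₀ y₁ z :=
    mem_range_of_exists_le_of_exists_ge hc ⟨x, by simpa using hle⟩ ⟨x₀, by simpa using h.le⟩
  have := congrFun ((F.isSol_sol x₀ y₂).eq (F.isSol_sol x₀ y₁) (sub_eq_zero.1 hz)) x₀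
  simp only [sol_self] at this
  exact h.ne' this

theorem continuous_sol_left (x₀ x : ℝ) : Continuous fun y => F.sol x₀ y x :=
  (F.strictMono_sol x₀ x).monotone.continuous_of_surjective fun y =>
    ⟨F.sol x y x₀, by simp⟩

theorem IsSol.abs_sub_le {F : SlopeField} {g : ℝ → ℝ} (h : F.IsSol g) (x x' : ℝ) :
    |g x - g x'| ≤ F.M * |x - x'| := by
  have := convex_univ.norm_image_sub_le_of_norm_hasDerivWithin_le (f := g)
    (fun z _ => (h z).hasDerivWithinAt) (fun z _ => F.bound z (g z)) (mem_univ x') (mem_univ x)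
  simpa using this

/-- The solution with value `w` at `0` depends continuously on the point and on `w`. -/
theorem continuous_sol_zero : Continuous fun p : ℝ × ℝ => F.sol 0 p.2 p.1 := by
  rw [continuous_iff_continuousAt]
  rintro ⟨x₀, w₀⟩
  have h1 : Tendsto (fun p : ℝ × ℝ => F.sol 0 p.2 x₀) (𝓝 (x₀, w₀)) (𝓝 (F.sol 0 w₀ x₀)) :=
    ((F.continuous_sol_left 0 x₀).comp continuous_snd).tendsto (x₀, w₀)
  have h2 : Tendsto (fun p : ℝ × ℝ => F.M * |p.1 - x₀|) (𝓝 (x₀, w₀)) (𝓝 0) := by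
    have : Continuous (fun p : ℝ × ℝ => F.M * |p.1 - x₀|) := by fun_prop
    simpa using this.tendsto (x₀, w₀)
  have h3 : Tendsto (fun p : ℝ × ℝ => F.sol 0 p.2 p.1 - F.sol 0 p.2 x₀) (𝓝 (x₀, w₀)) (𝓝 0) :=
    squeeze_zero_norm (fun p => (F.isSol_sol 0 p.2).abs_sub_le p.1 x₀) h2
  simpa [ContinuousAt] using h3.add h1

/-- The value at `0` of the solution through a point, as a function of the point: this is the first
integral of the slope field. -/
noncomputable def Phi (x y : ℝ) : ℝ := F.sol x y 0

theorem continuous_Phi : Continuous fun p : ℝ × ℝ => F.Phi p.1 p.2 := by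
  rw [continuous_iff_continuousAt]
  rintro ⟨x₀, y₀⟩
  have h0 : Tendsto (fun p : ℝ × ℝ => F.sol p.1 p.2 x₀) (𝓝 (x₀, y₀)) (𝓝 y₀) := by
    have h2 : Tendsto (fun p : ℝ × ℝ => F.M * |x₀ - p.1|) (𝓝 (x₀, y₀)) (𝓝 0) := by
      have : Continuous (fun p : ℝ × ℝ => F.M * |x₀ - p.1|) := by fun_prop
      simpa using this.tendsto (x₀, y₀)
    have h3 : Tendsto (fun p : ℝ × ℝ => F.sol p.1 p.2 x₀ - p.2) (𝓝 (x₀, y₀)) (𝓝 0) := by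
      refine squeeze_zero_norm (fun p => ?_) h2
      simpa using (F.isSol_sol p.1 p.2).abs_sub_le x₀ p.1
    simpa using h3.add (continuous_snd.tendsto (x₀, y₀))
  have h1 := ((F.continuous_sol_left x₀ 0).tendsto y₀).comp h0
  simpa [ContinuousAt, Phi, Function.comp_def] using h1

@[simp] theorem Phi_zero (y : ℝ) : F.Phi 0 y = y := F.sol_self 0 y

@[simp] theorem Phi_sol (w x : ℝ) : F.Phi x (F.sol 0 w x) = w := by simp [Phi]

@[simp] theorem sol_Phi (x y : ℝ) : F.sol 0 (F.Phi x y) x = y := by simp [Phi]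

theorem strictMono_Phi (x : ℝ) : StrictMono (F.Phi x) := F.strictMono_sol x 0

/-- Solutions steeper than the slope `κ`. -/
theorem IsSol.strictMono_sub {F : SlopeField} {g : ℝ → ℝ} (h : F.IsSol g) {κ : ℝ}
    (hκ : ∀ x y, κ < F x y) : StrictMono fun x => g x - κ * x :=
  strictMono_of_hasDerivAt_pos (f' := fun x => F x (g x) - κ)
    (fun x => by simpa using (h x).fun_sub ((hasDerivAt_id x).const_mul κ))
    (fun x => sub_pos.2 (hκ _ _))

theorem IsSol.strictAnti_sub {F : SlopeField} {g : ℝ → ℝ} (h : F.IsSol g) {κ : ℝ}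
    (hκ : ∀ x y, F x y < κ) : StrictAnti fun x => g x - κ * x :=
  strictAnti_of_hasDerivAt_neg (f' := fun x => F x (g x) - κ)
    (fun x => by simpa using (h x).fun_sub ((hasDerivAt_id x).const_mul κ))
    (fun x => sub_neg.2 (hκ _ _))

theorem Phi_axis_lt {κ x : ℝ} (hκ : ∀ x y, κ < F x y) (hx : 0 < x) : F.Phi x 0 < -κ * x := by
  simpa [Phi] using (F.isSol_sol x 0).strictMono_sub hκ hx

theorem lt_Phi_axis {κ x : ℝ} (hκ : ∀ x y, κ < F x y) (hx : x < 0) : -κ * x < F.Phi x 0 := by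
  simpa [Phi] using (F.isSol_sol x 0).strictMono_sub hκ hx

theorem lt_Phi_axis' {κ x : ℝ} (hκ : ∀ x y, F x y < κ) (hx : 0 < x) : -κ * x < F.Phi x 0 := by
  simpa [Phi] using (F.isSol_sol x 0).strictAnti_sub hκ hx

theorem Phi_axis_lt' {κ x : ℝ} (hκ : ∀ x y, F x y < κ) (hx : x < 0) : F.Phi x 0 < -κ * x := by
  simpa [Phi] using (F.isSol_sol x 0).strictAnti_sub hκ hx

theorem continuous_Phi_axis : Continuous fun x => F.Phi x 0 :=
  F.continuous_Phi.comp (by fun_prop : Continuous fun x : ℝ => (x, (0 : ℝ)))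

theorem strictAnti_Phi_axis (h : ∀ x y, 0 < F x y) : StrictAnti fun x => F.Phi x 0 := by
  intro x x' hx
  have h1 : 0 < F.sol x 0 x' := by simpa using (F.isSol_sol x 0).strictMono_sub h hx
  have h2 := F.strictMono_Phi x' h1
  simpa [Phi] using h2

theorem strictMono_Phi_axis (h : ∀ x y, F x y < 0) : StrictMono fun x => F.Phi x 0 := by
  intro x x' hx
  have h1 : F.sol x 0 x' < 0 := by simpa using (F.isSol_sol x 0).strictAnti_sub h hx
  have h2 := F.strictMono_Phi x' h1
  simpa [Phi] using h2

theorem surjective_Phi_axis_of_lt {l : ℝ} (hl : 0 < l) (h : ∀ x y, l < F x y) :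
    Function.Surjective fun x => F.Phi x 0 := by
  refine F.continuous_Phi_axis.surjective' ?_ ?_
  · refine tendsto_atTop_mono' _ ?_ (tendsto_id.const_mul_atBot_of_neg (neg_neg_of_pos hl))
    filter_upwards [eventually_lt_atBot 0] with x hx using (F.lt_Phi_axis h hx).le
  · refine tendsto_atBot_mono' _ ?_ (tendsto_id.const_mul_atTop_of_neg (neg_neg_of_pos hl))
    filter_upwards [eventually_gt_atTop 0] with x hx using (F.Phi_axis_lt h hx).le

theorem surjective_Phi_axis_of_gt {l : ℝ} (hl : l < 0) (h : ∀ x y, F x y < l) :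
    Function.Surjective fun x => F.Phi x 0 := by
  refine F.continuous_Phi_axis.surjective ?_ ?_
  · refine tendsto_atTop_mono' _ ?_ (tendsto_id.const_mul_atTop (neg_pos.2 hl))
    filter_upwards [eventually_gt_atTop 0] with x hx using (F.lt_Phi_axis' h hx).le
  · refine tendsto_atBot_mono' _ ?_ (tendsto_id.const_mul_atBot (neg_pos.2 hl))
    filter_upwards [eventually_lt_atBot 0] with x hx using (F.Phi_axis_lt' h hx).le

/-- A planar curve with horizontal velocity `v t` and vertical velocity `v t * F (x t) (y t)`
on `(a, b)` runs along a solution of the slope field up to the end points. The first integral thus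
has the same value at both of them. -/
theorem Phi_eq_of_curve {x y v : ℝ → ℝ} {a b C : ℝ} (hab : a ≤ b)
    (hx : ContinuousOn x (Icc a b)) (hy : ContinuousOn y (Icc a b))
    (hv : ∀ t ∈ Ioo a b, |v t| ≤ C)
    (hx' : ∀ t ∈ Ioo a b, HasDerivAt x (v t) t)
    (hy' : ∀ t ∈ Ioo a b, HasDerivAt y (v t * F (x t) (y t)) t) :
    F.Phi (x a) (y a) = F.Phi (x b) (y b) := by
  have key : ∀ a' ∈ Ioo a b, F.Phi (x a') (y a') = F.Phi (x b) (y b) := by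
    intro a' ha'
    have hsub : Icc a' b ⊆ Icc a b := Icc_subset_Icc_left ha'.1.le
    have hin : ∀ t ∈ Ico a' b, t ∈ Ioo a b := fun t ht => ⟨ha'.1.trans_le ht.1, ht.2⟩
    have hg := F.isSol_sol (x a') (y a')
    have := ODE_solution_unique_of_mem_Icc_right
      (v := fun t z => v t * F (x t) z) (s := fun _ => univ) (K := Real.toNNReal C * F.K)
      (f := y) (g := fun t => F.sol (x a') (y a') (x t)) (a := a') (b := b)
      (fun t ht => LipschitzOnWith.of_dist_le_mul fun z _ z' _ => by
        have h1 := (F.lipschitz (x t)).dist_le_mul z z'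
        have h2 := hv t (hin t ht)
        rw [Real.dist_eq] at h1 ⊢
        rw [← mul_sub, abs_mul]
        have hC : C ≤ (Real.toNNReal C : ℝ) := Real.le_coe_toNNReal C
        push_cast
        rw [mul_assoc]
        exact mul_le_mul (h2.trans hC) h1 (abs_nonneg _) (by positivity))
      (hy.mono hsub) (fun t ht => (hy' t (hin t ht)).hasDerivWithinAt) (fun t _ => mem_univ _)
      (hg.continuous.comp_continuousOn (hx.mono hsub))
      (fun t ht => by
        have := (hg (x t)).comp t (hx' t (hin t ht))
        rw [mul_comm] at this
        exact this.hasDerivWithinAt)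
      (fun t _ => mem_univ _) (by simp) (right_mem_Icc.2 ha'.2.le)
    rw [this]
    simp [Phi]
  rcases hab.eq_or_lt with rfl | hab
  · rfl
  have hc : ContinuousOn (fun t => F.Phi (x t) (y t)) (Icc a b) :=
    F.continuous_Phi.comp_continuousOn (hx.prodMk hy)
  have h1 := (hc a (left_mem_Icc.2 hab.le)).tendsto.mono_left
    (nhdsWithin_mono a Ioo_subset_Icc_self)
  rw [nhdsWithin_Ioo_eq_nhdsGT hab] at h1
  refine tendsto_nhds_unique (h1.congr' ?_) tendsto_const_nhds
  filter_upwards [Ioo_mem_nhdsGT hab] with t ht using key t ht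

end SlopeField

/-! ### Conjugacy of pairs of involutions of the line -/

theorem OrderIso.exists_pow_apply_le {T : ℝ ≃o ℝ} (hT : ∀ s, T s < s) (s b : ℝ) :
    ∃ n : ℕ, (T ^ n) s ≤ b := by
  by_contra! hb
  have hsucc : ∀ n : ℕ, (T ^ (n + 1)) s = T ((T ^ n) s) := fun n => by
    rw [pow_succ']; rfl
  have hanti : Antitone fun n : ℕ => (T ^ n) s :=
    antitone_nat_of_succ_le fun n => by rw [hsucc]; exact (hT _).le
  have hlim := tendsto_atTop_ciInf hanti ⟨b, by rintro _ ⟨n, rfl⟩; exact (hb n).le⟩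
  have h1 := (T.continuous.tendsto _).comp hlim
  have h2 := hlim.comp (tendsto_add_atTop_nat 1)
  -- the limit of the orbit would be a fixed point
  refine (hT _).ne (tendsto_nhds_unique h1 (h2.congr fun n => ?_))
  exact hsucc n

/-- A homeomorphism of the line that moves every point to the left is conjugate to the unit
translation. The conjugacy is affine on the fundamental domain `(T 0, 0]`. -/
theorem OrderIso.exists_abel (T : ℝ ≃o ℝ) (hT : ∀ s, T s < s) :
    ∃ g : ℝ ≃o ℝ, ∀ s, g (T s) = g s - 1 := by
  have hsucc : ∀ (n : ℤ) (s : ℝ), (T ^ (n + 1)) s = T ((T ^ n) s) := fun n s => by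
    rw [add_comm, zpow_add, zpow_one]; rfl
  have hadd : ∀ (m n : ℤ) (s : ℝ), (T ^ (m + n)) s = (T ^ m) ((T ^ n) s) := fun m n s => by
    rw [zpow_add]; rfl
  have hanti : ∀ s, StrictAnti fun n : ℤ => (T ^ n) s := fun s =>
    strictAnti_int_of_succ_lt fun n => by rw [hsucc]; exact hT _
  have hex : ∀ s, ∃ n : ℤ, T 0 < (T ^ n) s ∧ (T ^ n) s ≤ 0 := by
    intro s
    obtain ⟨m, hm⟩ := OrderIso.exists_pow_apply_le hT s 0
    obtain ⟨k, hk⟩ := OrderIso.exists_pow_apply_le hT 0 (s - 1)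
    have hk' : 0 < (T ^ (-(k : ℤ))) s := by
      have h1 : (T ^ (k : ℤ)) 0 < s := by
        rw [zpow_natCast]; linarith
      have h2 := (T ^ (-(k : ℤ))).strictMono h1
      rwa [← hadd, neg_add_cancel] at h2
    obtain ⟨n, hn, hmin⟩ := Int.exists_least_of_bdd (P := fun n : ℤ => (T ^ n) s ≤ 0)
      ⟨-(k : ℤ), fun z hz => by
        by_contra! h
        exact absurd (hk'.trans ((hanti s) h)) (not_lt.2 hz)⟩
      ⟨m, by rw [zpow_natCast]; exact hm⟩
    refine ⟨n, ?_, hn⟩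
    have h1 : 0 < (T ^ (n - 1)) s := by
      by_contra! h
      have := hmin _ h
      omega
    have h2 := T.strictMono h1
    rwa [← hsucc, sub_add_cancel] at h2
  choose N hN hN' using hex
  have hNuniq : ∀ (s : ℝ) (n : ℤ), T 0 < (T ^ n) s → (T ^ n) s ≤ 0 → N s = n := by
    intro s n h1 h2
    have aux : ∀ m k : ℤ, T 0 < (T ^ m) s → (T ^ k) s ≤ 0 → m ≤ k := by
      intro m k hm hk
      by_contra! h
      have h3 : (T ^ m) s ≤ (T ^ (k + 1)) s := (hanti s).antitone (by omega)
      rw [hsucc] at h3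
      exact absurd (hm.trans_le (h3.trans (T.monotone hk))) (lt_irrefl _)
    exact le_antisymm (aux _ _ (hN s) h2) (aux _ _ h1 (hN' s))
  have hc : T 0 < 0 := hT 0
  set c := T 0 with hcdef
  have hlin : ∀ s, 0 < ((T ^ N s) s - c) / (-c) ∧ ((T ^ N s) s - c) / (-c) ≤ 1 := fun s =>
    ⟨div_pos (by linarith [hN s]) (by linarith), (div_le_one (by linarith)).2 (by linarith [hN' s])⟩
  have hmono : StrictMono fun s => (N s : ℝ) + ((T ^ N s) s - c) / (-c) := by
    intro s s' hs
    rcases lt_trichotomy (N s) (N s') with h | h | h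
    · have h' : (N s : ℝ) + 1 ≤ N s' := by exact_mod_cast h
      have := (hlin s).2
      have := (hlin s').1
      show (N s : ℝ) + _ < N s' + _
      linarith
    · show (N s : ℝ) + _ < N s' + _
      rw [h]
      have : (T ^ N s') s < (T ^ N s') s' := (T ^ N s').strictMono hs
      gcongr
      linarith
    · exfalso
      -- the larger point cannot enter the fundamental domain strictly earlier
      have h1 : (T ^ N s) s < (T ^ N s) s' := (T ^ N s).strictMono hs
      have h2 : (T ^ N s) s' ≤ (T ^ (N s' + 1)) s' := (hanti s').antitone (by omega)
      rw [hsucc] at h2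
      have h3 := T.monotone (hN' s')
      linarith [hN s]
  have hstep : ∀ s, N (T s) = N s - 1 := by
    intro s
    have h : (T ^ (N s - 1)) (T s) = (T ^ N s) s := by
      conv_lhs => rw [← (by simp : (T ^ (1 : ℤ)) s = T s), ← hadd, sub_add_cancel]
    exact hNuniq _ _ (by rw [h]; exact hN s) (by rw [h]; exact hN' s)
  have hstep' : ∀ s, (T ^ N (T s)) (T s) = (T ^ N s) s := by
    intro s
    rw [hstep]
    conv_lhs => rw [← (by simp : (T ^ (1 : ℤ)) s = T s), ← hadd, sub_add_cancel]
  have hsurj : Function.Surjective fun s => (N s : ℝ) + ((T ^ N s) s - c) / (-c) := by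
    intro w
    set k : ℤ := ⌈w⌉ - 1 with hk
    set z : ℝ := c + (w - k) * (-c) with hz
    have hk1 : (k : ℝ) = ⌈w⌉ - 1 := by rw [hk]; push_cast; ring
    have hw1 : 0 < w - k := by rw [hk1]; linarith [Int.ceil_lt_add_one w]
    have hw2 : w - k ≤ 1 := by rw [hk1]; linarith [Int.le_ceil w]
    have hz1 : c < z := by rw [hz]; nlinarith
    have hz2 : z ≤ 0 := by rw [hz]; nlinarith
    have hTk : (T ^ k) ((T ^ (-k)) z) = z := by rw [← hadd]; simp
    have hNk : N ((T ^ (-k)) z) = k := hNuniq _ _ (by rwa [hTk]) (by rwa [hTk])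
    refine ⟨(T ^ (-k)) z, ?_⟩
    show (N ((T ^ (-k)) z) : ℝ) + _ = w
    rw [hNk, hTk, hz]
    have : -c ≠ 0 := by linarith
    rw [add_sub_cancel_left, mul_div_cancel_right₀ _ this]
    ring
  refine ⟨hmono.orderIsoOfSurjective _ hsurj, fun s => ?_⟩
  show (N (T s) : ℝ) + _ = (N s : ℝ) + _ - 1
  rw [hstep', hstep]
  push_cast
  ring

/-- A pair of decreasing involutions of the line with the common fixed point `0`. -/
structure InvolutionPair where
  a : ℝ → ℝ
  b : ℝ → ℝ
  a_a : ∀ x, a (a x) = x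
  b_b : ∀ x, b (b x) = x
  a_anti : StrictAnti a
  b_anti : StrictAnti b
  a_zero : a 0 = 0
  b_zero : b 0 = 0

namespace InvolutionPair

variable (P P' : InvolutionPair)

theorem a_neg {x : ℝ} (hx : 0 < x) : P.a x < 0 := by simpa [P.a_zero] using P.a_anti hx
theorem a_pos {x : ℝ} (hx : x < 0) : 0 < P.a x := by simpa [P.a_zero] using P.a_anti hx
theorem b_neg {x : ℝ} (hx : 0 < x) : P.b x < 0 := by simpa [P.b_zero] using P.b_anti hx
theorem b_pos {x : ℝ} (hx : x < 0) : 0 < P.b x := by simpa [P.b_zero] using P.b_anti hx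

/-- A parameter on the half-line in which the composition of the involutions is a translation. -/
theorem exists_param (h : ∀ x > 0, P.b (P.a x) < x) :
    ∃ e : ℝ ≃o Ioi (0 : ℝ), ∀ s, P.b (P.a (e s)) = e (s - 1) := by
  have hpos : ∀ s, 0 < P.b (P.a (Real.exp s)) := fun s => P.b_pos (P.a_neg (Real.exp_pos s))
  have hmono : StrictMono fun s => Real.log (P.b (P.a (Real.exp s))) := fun s s' hs =>
    Real.log_lt_log (hpos s) (P.b_anti (P.a_anti (Real.exp_lt_exp.2 hs)))
  have hsurj : Function.Surjective fun s => Real.log (P.b (P.a (Real.exp s))) := fun w =>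
    ⟨Real.log (P.a (P.b (Real.exp w))), by
      simp only [Real.exp_log (P.a_pos (P.b_neg (Real.exp_pos w))), P.a_a, P.b_b, Real.log_exp]⟩
  obtain ⟨g, hg⟩ := OrderIso.exists_abel (hmono.orderIsoOfSurjective _ hsurj) fun s => by
    show Real.log (P.b (P.a (Real.exp s))) < s
    rw [Real.log_lt_iff_lt_exp (hpos s)]
    exact h _ (Real.exp_pos s)
  refine ⟨g.symm.trans Real.expOrderIso, fun s => ?_⟩
  have h1 := hg (g.symm s)
  rw [g.apply_symm_apply] at h1
  show P.b (P.a (Real.exp (g.symm s))) = Real.exp (g.symm (s - 1))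
  rw [← h1, g.symm_apply_apply]
  exact (Real.exp_log (hpos _)).symm

/-- The conjugacy on the half-line, where the composition `b ∘ a` is linearized, is carried to the
other half-line by the involution `a`; it then conjugates both involutions. -/
theorem exists_conj (h : ∀ x > 0, P.b (P.a x) < x) (h' : ∀ x > 0, P'.b (P'.a x) < x) :
    ∃ η : ℝ ≃o ℝ, η 0 = 0 ∧ (∀ x, η (P.a x) = P'.a (η x)) ∧ ∀ x, η (P.b x) = P'.b (η x) := by
  obtain ⟨e, he⟩ := P.exists_param h
  obtain ⟨e', he'⟩ := P'.exists_param h'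
  let k : ℝ → ℝ := fun x => if hx : 0 < x then (e' (e.symm ⟨x, hx⟩) : ℝ) else 0
  have hk : ∀ {x} (hx : 0 < x), k x = e' (e.symm ⟨x, hx⟩) := fun hx => dif_pos hx
  have hkpos : ∀ {x}, 0 < x → 0 < k x := fun hx => by rw [hk hx]; exact (e' _).2
  have hkmono : ∀ {x y}, 0 < x → x < y → k x < k y := fun {x y} hx hxy => by
    rw [hk hx, hk (hx.trans hxy)]
    exact e'.strictMono (e.symm.strictMono hxy)
  have hksurj : ∀ {y}, 0 < y → ∃ x, 0 < x ∧ k x = y := fun {y} hy =>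
    ⟨e (e'.symm ⟨y, hy⟩), (e _).2, by rw [hk (e _).2]; simp⟩
  have hkQ : ∀ {x}, 0 < x → k (P.b (P.a x)) = P'.b (P'.a (k x)) := fun {x} hx => by
    obtain ⟨s, hs⟩ := e.surjective ⟨x, hx⟩
    have hsx : (e s : ℝ) = x := congrArg Subtype.val hs
    rw [hk hx, ← hs, e.symm_apply_apply, he', ← hsx, he, hk (e _).2]
    simp
  let f : ℝ → ℝ := fun x => if 0 < x then k x else if x = 0 then 0 else P'.a (k (P.a x))
  have fpos : ∀ {x}, 0 < x → f x = k x := fun hx => if_pos hx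
  have fzero : f 0 = 0 := by simp [f]
  have fneg : ∀ {x}, x < 0 → f x = P'.a (k (P.a x)) := fun {x} hx => by
    simp [f, hx.not_gt, hx.ne]
  have fneg' : ∀ {x}, x < 0 → f x < 0 := fun hx => by
    rw [fneg hx]; exact P'.a_neg (hkpos (P.a_pos hx))
  have fpos' : ∀ {x}, 0 < x → 0 < f x := fun hx => by rw [fpos hx]; exact hkpos hx
  have hmono : StrictMono f := by
    intro x y hxy
    rcases lt_trichotomy x 0 with hx | rfl | hx
    · rcases lt_trichotomy y 0 with hy | rfl | hy
      · rw [fneg hx, fneg hy]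
        exact P'.a_anti (hkmono (P.a_pos hy) (P.a_anti hxy))
      · rw [fzero]; exact fneg' hx
      · exact (fneg' hx).trans (fpos' hy)
    · rw [fzero]; exact fpos' hxy
    · rw [fpos hx, fpos (hx.trans hxy)]; exact hkmono hx hxy
  have hsurj : Function.Surjective f := by
    intro y
    rcases lt_trichotomy y 0 with hy | rfl | hy
    · obtain ⟨x, hx, hxy⟩ := hksurj (P'.a_pos hy)
      exact ⟨P.a x, by rw [fneg (P.a_neg hx), P.a_a, hxy, P'.a_a]⟩
    · exact ⟨0, fzero⟩
    · obtain ⟨x, hx, hxy⟩ := hksurj hy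
      exact ⟨x, by rw [fpos hx, hxy]⟩
  have hfa : ∀ x, f (P.a x) = P'.a (f x) := by
    intro x
    rcases lt_trichotomy x 0 with hx | rfl | hx
    · rw [fpos (P.a_pos hx), fneg hx, P'.a_a]
    · rw [P.a_zero, fzero, P'.a_zero]
    · rw [fneg (P.a_neg hx), P.a_a, fpos hx]
  have hfb' : ∀ {x}, 0 < x → f (P.b x) = P'.b (f x) := fun {x} hx => by
    -- write `b = (b ∘ a)⁻¹ ∘ a` on the positive half-line
    have hy : 0 < P.a (P.b x) := P.a_pos (P.b_neg hx)
    have h1 := hkQ hy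
    rw [P.a_a, P.b_b, ← fpos hx] at h1
    rw [fneg (P.b_neg hx), h1, P'.b_b]
  refine ⟨hmono.orderIsoOfSurjective _ hsurj, fzero, hfa, fun x => ?_⟩
  show f (P.b x) = P'.b (f x)
  rcases lt_trichotomy x 0 with hx | rfl | hx
  · have h1 := hfb' (P.b_pos hx)
    rw [P.b_b] at h1
    rw [h1, P'.b_b]
  · rw [P.b_zero, fzero, P'.b_zero]
  · exact hfb' hx

end InvolutionPair

/-! ### Gluing of homeomorphisms of the line at the origin -/

/-- The increasing homeomorphism equal to `φ` on the left and to `ψ` on the right of the origin,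
which both fix. -/
noncomputable def glueIso (φ ψ : ℝ ≃o ℝ) (hφ : φ 0 = 0) (hψ : ψ 0 = 0) : ℝ ≃o ℝ :=
  StrictMono.orderIsoOfSurjective (fun x => if x ≤ 0 then φ x else ψ x)
    (by
      intro x y hxy
      have h1 : ∀ {z}, z ≤ 0 → φ z ≤ 0 := fun hz => hφ ▸ φ.monotone hz
      have h2 : ∀ {z}, 0 < z → 0 < ψ z := fun {z} hz => by
        have := ψ.strictMono hz
        rwa [hψ] at this
      show (if x ≤ 0 then φ x else ψ x) < if y ≤ 0 then φ y else ψ y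
      split_ifs with hx hy hy
      · exact φ.strictMono hxy
      · exact (h1 hx).trans_lt (h2 (not_le.1 hy))
      · linarith
      · exact ψ.strictMono hxy)
    (by
      intro y
      rcases le_or_gt y 0 with hy | hy
      · refine ⟨φ.symm y, ?_⟩
        have : φ.symm y ≤ 0 := by rw [OrderIso.symm_apply_le, hφ]; exact hy
        simp [this]
      · refine ⟨ψ.symm y, ?_⟩
        have : ¬ ψ.symm y ≤ 0 := by rw [OrderIso.symm_apply_le, hψ]; exact not_le.2 hy
        simp [this])

section glueIso

variable {φ ψ : ℝ ≃o ℝ} (hφ : φ 0 = 0) (hψ : ψ 0 = 0)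

theorem glueIso_of_nonpos {x : ℝ} (hx : x ≤ 0) : glueIso φ ψ hφ hψ x = φ x := if_pos hx

theorem glueIso_of_nonneg {x : ℝ} (hx : 0 ≤ x) : glueIso φ ψ hφ hψ x = ψ x := by
  rcases hx.eq_or_lt with rfl | hx
  · rw [glueIso_of_nonpos hφ hψ le_rfl, hφ, hψ]
  · exact if_neg (not_le.2 hx)

@[simp] theorem glueIso_zero : glueIso φ ψ hφ hψ 0 = 0 := by
  rw [glueIso_of_nonpos hφ hψ le_rfl, hφ]

theorem glueIso_symm_of_nonpos {x : ℝ} (hx : x ≤ 0) :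
    (glueIso φ ψ hφ hψ).symm x = φ.symm x := by
  rw [OrderIso.symm_apply_eq, glueIso_of_nonpos, OrderIso.apply_symm_apply]
  rw [OrderIso.symm_apply_le, hφ]; exact hx

theorem glueIso_symm_of_nonneg {x : ℝ} (hx : 0 ≤ x) :
    (glueIso φ ψ hφ hψ).symm x = ψ.symm x := by
  rw [OrderIso.symm_apply_eq, glueIso_of_nonneg, OrderIso.apply_symm_apply]
  rw [OrderIso.le_symm_apply, hψ]; exact hx

end glueIso

namespace OrderIso

theorem pos_of_pos {φ : ℝ ≃o ℝ} (h0 : φ 0 = 0) {x : ℝ} : 0 < φ x ↔ 0 < x := by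
  conv_lhs => rw [← h0, φ.lt_iff_lt]

theorem neg_of_neg {φ : ℝ ≃o ℝ} (h0 : φ 0 = 0) {x : ℝ} : φ x < 0 ↔ x < 0 := by
  conv_lhs => rw [← h0, φ.lt_iff_lt]

theorem symm_zero {φ : ℝ ≃o ℝ} (h0 : φ 0 = 0) : φ.symm 0 = 0 := by
  rw [OrderIso.symm_apply_eq, h0]

/-- The conjugate by `A` of the reflection of the line. -/
noncomputable def reflection (A : ℝ ≃o ℝ) (x : ℝ) : ℝ := A.symm (-A x)

theorem apply_reflection (A : ℝ ≃o ℝ) (x : ℝ) : A (A.reflection x) = -A x := by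
  simp [reflection]

theorem reflection_reflection (A : ℝ ≃o ℝ) (x : ℝ) : A.reflection (A.reflection x) = x := by
  simp [reflection]

theorem strictAnti_reflection (A : ℝ ≃o ℝ) : StrictAnti A.reflection := fun _ _ h =>
  A.symm.strictMono (neg_lt_neg (A.strictMono h))

theorem reflection_zero {A : ℝ ≃o ℝ} (h0 : A 0 = 0) : A.reflection 0 = 0 := by
  simp [reflection, h0, symm_zero h0]

end OrderIso

/-- The reflections conjugated by `A` and by `B`. -/
noncomputable def reflectionPair (A B : ℝ ≃o ℝ) (hA : A 0 = 0) (hB : B 0 = 0) :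
    InvolutionPair where
  a := A.reflection
  b := B.reflection
  a_a := A.reflection_reflection
  b_b := B.reflection_reflection
  a_anti := A.strictAnti_reflection
  b_anti := B.strictAnti_reflection
  a_zero := OrderIso.reflection_zero hA
  b_zero := OrderIso.reflection_zero hB

/-- `φ` grows slower, and `ψ` faster, than the linear map of slope `κ`. -/
def Separated (κ : ℝ) (φ ψ : ℝ ≃o ℝ) : Prop :=
  ∀ x, (0 < x → φ x < κ * x ∧ κ * x < ψ x) ∧ (x < 0 → κ * x < φ x ∧ ψ x < κ * x)

theorem Separated.reflection_lt {κ : ℝ} (hκ : 0 < κ) {φ ψ : ℝ ≃o ℝ} (h : Separated κ φ ψ)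
    (hφ : φ 0 = 0) (hψ : ψ 0 = 0) {x : ℝ} (hx : 0 < x) :
    (glueIso φ ψ hφ hψ).reflection ((glueIso ψ φ hψ hφ).reflection x) < x := by
  have h1 := (glueIso ψ φ hψ hφ).apply_reflection x
  set z := (glueIso ψ φ hψ hφ).reflection x with hz
  have hz0 : z < 0 := by
    have := (glueIso ψ φ hψ hφ).strictAnti_reflection hx
    rwa [OrderIso.reflection_zero (glueIso_zero _ _)] at this
  have h2 := (glueIso φ ψ hφ hψ).apply_reflection z
  set w := (glueIso φ ψ hφ hψ).reflection z with hw
  have hw0 : 0 < w := by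
    have := (glueIso φ ψ hφ hψ).strictAnti_reflection hz0
    rwa [OrderIso.reflection_zero (glueIso_zero _ _)] at this
  rw [glueIso_of_nonpos hψ hφ hz0.le, glueIso_of_nonneg hψ hφ hx.le] at h1
  rw [glueIso_of_nonpos hφ hψ hz0.le, glueIso_of_nonneg hφ hψ hw0.le] at h2
  have a1 := (h x).1 hx
  have a2 := (h z).2 hz0
  have a3 := (h w).1 hw0
  have : κ * w < κ * x := by linarith
  exact lt_of_mul_lt_mul_left this hκ.le

/-- The one-dimensional part of the equivalence: a conjugacy `η` of the two return involutions,
together with the maps of the values of the first integrals that it induces, which are odd. -/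
theorem exists_conjugacy_of_separated {κ κ' : ℝ} (hκ : 0 < κ) (hκ' : 0 < κ')
    {φ ψ φ' ψ' : ℝ ≃o ℝ} (hφ : φ 0 = 0) (hψ : ψ 0 = 0) (hφ' : φ' 0 = 0) (hψ' : ψ' 0 = 0)
    (h : (Separated κ φ ψ ∧ Separated κ' φ' ψ') ∨ (Separated κ ψ φ ∧ Separated κ' ψ' φ')) :
    ∃ η ωA ωB : ℝ ≃o ℝ, η 0 = 0 ∧ (∀ x, ωA (-x) = -ωA x) ∧ (∀ x, ωB (-x) = -ωB x) ∧
      (∀ x, ωA (glueIso ψ φ hψ hφ x) = glueIso ψ' φ' hψ' hφ' (η x)) ∧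
      (∀ x, ωB (glueIso φ ψ hφ hψ x) = glueIso φ' ψ' hφ' hψ' (η x)) := by
  obtain ⟨η, h0, hA, hB⟩ : ∃ η : ℝ ≃o ℝ, η 0 = 0 ∧
      (∀ x, η ((glueIso ψ φ hψ hφ).reflection x) = (glueIso ψ' φ' hψ' hφ').reflection (η x)) ∧
      (∀ x, η ((glueIso φ ψ hφ hψ).reflection x) =
        (glueIso φ' ψ' hφ' hψ').reflection (η x)) := by
    rcases h with ⟨h, h'⟩ | ⟨h, h'⟩
    · exact (reflectionPair _ _ (glueIso_zero hψ hφ) (glueIso_zero hφ hψ)).exists_conj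
        (reflectionPair _ _ (glueIso_zero hψ' hφ') (glueIso_zero hφ' hψ'))
        (fun x hx => h.reflection_lt hκ hφ hψ hx) (fun x hx => h'.reflection_lt hκ' hφ' hψ' hx)
    · obtain ⟨η, h0, hA, hB⟩ :=
        (reflectionPair _ _ (glueIso_zero hφ hψ) (glueIso_zero hψ hφ)).exists_conj
        (reflectionPair _ _ (glueIso_zero hφ' hψ') (glueIso_zero hψ' hφ'))
        (fun x hx => h.reflection_lt hκ hψ hφ hx) (fun x hx => h'.reflection_lt hκ' hψ' hφ' hx)
      exact ⟨η, h0, hB, hA⟩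
  have aux : ∀ A A' : ℝ ≃o ℝ, (∀ x, η (A.reflection x) = A'.reflection (η x)) →
      ∃ ω : ℝ ≃o ℝ, (∀ x, ω (-x) = -ω x) ∧ ∀ x, ω (A x) = A' (η x) := by
    intro A A' hAA
    refine ⟨(A.symm.trans η).trans A', fun x => ?_, fun x => by simp⟩
    have := hAA (A.symm x)
    rw [OrderIso.reflection, OrderIso.apply_symm_apply] at this
    show A' (η (A.symm (-x))) = -A' (η (A.symm x))
    rw [this, OrderIso.apply_reflection]
  obtain ⟨ωA, oA, eA⟩ := aux _ _ hA
  obtain ⟨ωB, oB, eB⟩ := aux _ _ hB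
  exact ⟨η, ωA, ωB, h0, oA, oB, eA, eB⟩

/-! ### Monotone curves and changes of time -/

/-- Local growth to the right of every point gives strict growth on an interval. -/
theorem ContinuousOn.strictMonoOn_of_eventually_gt {x : ℝ → ℝ} {I : Set ℝ} (hI : I.OrdConnected)
    (hx : ContinuousOn x I) (h : ∀ t ∈ I, ∀ᶠ s in 𝓝[>] t, x t < x s) : StrictMonoOn x I := by
  intro a ha b hb hab
  have hsub : Icc a b ⊆ I := hI.out ha hb
  have hmax : ∀ c ∈ Icc a b, IsMaxOn x (Icc a b) c → c = b := by
    intro c hc hcm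
    by_contra hne
    have hcb : c < b := lt_of_le_of_ne hc.2 hne
    obtain ⟨s, hs1, hs2⟩ := ((h c (hsub hc)).and (Ioo_mem_nhdsGT hcb)).exists
    exact absurd (hcm ⟨hc.1.trans hs2.1.le, hs2.2.le⟩) (not_le.2 hs1)
  obtain ⟨c, hc, hcm⟩ := isCompact_Icc.exists_isMaxOn (nonempty_Icc.2 hab.le) (hx.mono hsub)
  have hcb := hmax c hc hcm
  subst hcb
  refine lt_of_le_of_ne (hcm (left_mem_Icc.2 hab.le)) fun heq => ?_
  have : IsMaxOn x (Icc a c) a := fun z hz => by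
    have := hcm hz
    simp only [mem_ofPred_eq] at this ⊢
    rwa [heq]
  exact hab.ne (hmax a (left_mem_Icc.2 hab.le) this)

theorem HasDerivAt.eventually_gt_right {x : ℝ → ℝ} {v t : ℝ} (h : HasDerivAt x v t) (hv : 0 < v) :
    ∀ᶠ s in 𝓝[>] t, x t < x s := by
  have h1 := (hasDerivAt_iff_tendsto_slope.1 h).mono_left
    (nhdsWithin_mono t (fun s (hs : s ∈ Ioi t) => (ne_of_gt hs)))
  filter_upwards [h1.eventually (lt_mem_nhds hv), self_mem_nhdsWithin] with s hs hst
  exact (slope_pos_iff_of_le (le_of_lt hst)).1 hs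

theorem StrictMonoOn.isOpen_image {τ : ℝ → ℝ} {I : Set ℝ} (hτ : StrictMonoOn τ I)
    (hc : ContinuousOn τ I) (ho : IsOpen I) (hI : I.OrdConnected) : IsOpen (τ '' I) := by
  rw [isOpen_iff_mem_nhds]
  rintro _ ⟨t, ht, rfl⟩
  obtain ⟨ε, hε, hsub⟩ := Metric.isOpen_iff.1 ho t ht
  rw [Real.ball_eq_Ioo] at hsub
  have ha : t - ε / 2 ∈ I := hsub ⟨by linarith, by linarith⟩
  have hb : t + ε / 2 ∈ I := hsub ⟨by linarith, by linarith⟩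
  have hab : Icc (t - ε / 2) (t + ε / 2) ⊆ I := hI.out ha hb
  refine mem_of_superset (Icc_mem_nhds (hτ ha ht (by linarith)) (hτ ht hb (by linarith))) ?_
  exact (intermediate_value_Icc (by linarith) (hc.mono hab)).trans (image_mono hab)

theorem ContinuousOn.ordConnected_image {τ : ℝ → ℝ} {I : Set ℝ} (hc : ContinuousOn τ I)
    (hI : I.OrdConnected) : (τ '' I).OrdConnected :=
  (hI.isPreconnected.image τ hc).ordConnected

/-- A continuous positive function on the plane, bounded and bounded away from zero. -/
structure Speed where
  toFun : ℝ × ℝ → ℝ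
  continuous_toFun : Continuous toFun
  lo : ℝ
  hi : ℝ
  lo_pos : 0 < lo
  lo_le : ∀ p, lo ≤ toFun p
  le_hi : ∀ p, toFun p ≤ hi

namespace Speed

instance : CoeFun Speed (fun _ => ℝ × ℝ → ℝ) := ⟨Speed.toFun⟩

theorem pos (v : Speed) (p : ℝ × ℝ) : 0 < v p := v.lo_pos.trans_le (v.lo_le p)

theorem abs_le (v : Speed) (p : ℝ × ℝ) : |v p| ≤ v.hi := by
  rw [abs_of_pos (v.pos p)]; exact v.le_hi p

/-- The time at which the abscissa `x` is reached along the graph of `g`, when the horizontal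
velocity is `v`; it is the integral of `1 / v`. -/
theorem exists_time (v : Speed) {g : ℝ → ℝ} (hg : Continuous g) :
    ∃ T : ℝ ≃o ℝ, T 0 = 0 ∧ ∀ s, HasDerivAt T.symm (v (T.symm s, g (T.symm s))) s := by
  have hcont : Continuous fun x => (v (x, g x))⁻¹ :=
    (v.continuous_toFun.comp (by fun_prop : Continuous fun x => (x, g x))).inv₀
      fun x => (v.pos _).ne'
  let T : ℝ → ℝ := fun x => ∫ z in (0 : ℝ)..x, (v (z, g z))⁻¹
  have hT : ∀ x, HasDerivAt T ((v (x, g x))⁻¹) x := fun x =>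
    (hcont.integral_hasStrictDerivAt 0 x).hasDerivAt
  have hT0 : T 0 = 0 := intervalIntegral.integral_same
  have hmono : StrictMono T :=
    strictMono_of_hasDerivAt_pos hT fun x => inv_pos.2 (v.pos _)
  have hhi : 0 < v.hi := (v.pos 0).trans_le (v.le_hi 0)
  have hlow : Monotone fun x => T x - v.hi⁻¹ * x :=
    monotone_of_hasDerivAt_nonneg (f' := fun x => (v (x, g x))⁻¹ - v.hi⁻¹)
      (fun x => by simpa using (hT x).fun_sub ((hasDerivAt_id x).const_mul v.hi⁻¹))
      (fun x => sub_nonneg.2 (inv_anti₀ (v.pos _) (v.le_hi _)))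
  have hsurj : Function.Surjective T := by
    have hc : Continuous T := continuous_iff_continuousAt.2 fun x => (hT x).continuousAt
    refine hc.surjective ?_ ?_
    · refine tendsto_atTop_mono' _ ?_ (tendsto_id.const_mul_atTop (inv_pos.2 hhi))
      filter_upwards [eventually_ge_atTop 0] with x hx
      have := hlow hx
      simp only [hT0, mul_zero, sub_zero] at this
      simpa using this
    · refine tendsto_atBot_mono' _ ?_ (tendsto_id.const_mul_atBot (inv_pos.2 hhi))
      filter_upwards [eventually_le_atBot 0] with x hx
      have := hlow hx
      simp only [hT0, mul_zero, sub_zero] at this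
      simpa using this
  refine ⟨hmono.orderIsoOfSurjective T hsurj, hT0, fun s => ?_⟩
  set E := hmono.orderIsoOfSurjective T hsurj
  have h1 : HasDerivAt E ((v (E.symm s, g (E.symm s)))⁻¹) (E.symm s) := hT _
  have := h1.of_local_left_inverse E.symm.continuous.continuousAt (inv_pos.2 (v.pos _)).ne'
    (Eventually.of_forall fun y => E.apply_symm_apply y)
  rwa [inv_inv] at this

end Speed

/-! ### The flow on a half-plane -/

/-- The vector fields `(v, v F)` on the left and `(u, u G)` on the right of the second axis, whose
trajectories are concatenated on that axis. -/
structure HalfModel where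
  F : SlopeField
  G : SlopeField
  v : Speed
  u : Speed

namespace HalfModel

variable (H : HalfModel)

/-- The first integral of the concatenated flow: the ordinate at which the trajectory of a point
meets the second axis. -/
noncomputable def W (x y : ℝ) : ℝ := if x ≤ 0 then H.F.Phi x y else H.G.Phi x y

/-- The ordinate above `x` of the trajectory on which the first integral is `w`. -/
noncomputable def V (x w : ℝ) : ℝ := if x ≤ 0 then H.F.sol 0 w x else H.G.sol 0 w x

theorem W_of_nonpos {x : ℝ} (hx : x ≤ 0) (y : ℝ) : H.W x y = H.F.Phi x y := if_pos hx

theorem W_of_nonneg {x : ℝ} (hx : 0 ≤ x) (y : ℝ) : H.W x y = H.G.Phi x y := by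
  rcases hx.eq_or_lt with rfl | hx
  · simp [W]
  · exact if_neg (not_le.2 hx)

theorem V_of_nonpos {x : ℝ} (hx : x ≤ 0) (w : ℝ) : H.V x w = H.F.sol 0 w x := if_pos hx

theorem V_of_nonneg {x : ℝ} (hx : 0 ≤ x) (w : ℝ) : H.V x w = H.G.sol 0 w x := by
  rcases hx.eq_or_lt with rfl | hx
  · simp [V]
  · exact if_neg (not_le.2 hx)

theorem W_V (x w : ℝ) : H.W x (H.V x w) = w := by
  unfold W V; split_ifs <;> simp

theorem V_W (x y : ℝ) : H.V x (H.W x y) = y := by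
  unfold W V; split_ifs <;> simp

theorem strictMono_W (x : ℝ) : StrictMono (H.W x) := by
  intro y y' h
  unfold W
  split_ifs
  · exact H.F.strictMono_Phi x h
  · exact H.G.strictMono_Phi x h

theorem strictMono_V (x : ℝ) : StrictMono (H.V x) := by
  intro y y' h
  unfold V
  split_ifs
  · exact H.F.strictMono_sol 0 x h
  · exact H.G.strictMono_sol 0 x h

theorem continuous_W : Continuous fun p : ℝ × ℝ => H.W p.1 p.2 :=
  H.F.continuous_Phi.if_le H.G.continuous_Phi continuous_fst continuous_const
    (by rintro ⟨x, y⟩ (rfl : x = 0); simp)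

theorem continuous_V : Continuous fun p : ℝ × ℝ => H.V p.1 p.2 :=
  H.F.continuous_sol_zero.if_le H.G.continuous_sol_zero continuous_fst continuous_const
    (by rintro ⟨x, y⟩ (rfl : x = 0); simp)

/-- The first integral as a second coordinate of the plane. -/
noncomputable def straighten : ℝ × ℝ ≃ₜ ℝ × ℝ where
  toFun p := (p.1, H.W p.1 p.2)
  invFun p := (p.1, H.V p.1 p.2)
  left_inv p := by simp [V_W]
  right_inv p := by simp [W_V]
  continuous_toFun := continuous_fst.prodMk H.continuous_W
  continuous_invFun := continuous_fst.prodMk H.continuous_V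

/-- The curve `(x, y)` obeys the concatenated flow at the time `t`. On the second axis only the
sign of `x` at the later times is recorded. -/
def Obeys (x y : ℝ → ℝ) (t : ℝ) : Prop :=
  (x t < 0 ∧ HasDerivAt x (H.v (x t, y t)) t ∧
    HasDerivAt y (H.v (x t, y t) * H.F (x t) (y t)) t) ∨
  (0 < x t ∧ HasDerivAt x (H.u (x t, y t)) t ∧
    HasDerivAt y (H.u (x t, y t) * H.G (x t) (y t)) t) ∨
  (x t = 0 ∧ ((∀ᶠ s in 𝓝[>] t, 0 < x s) ∨ ∀ᶠ s in 𝓝[>] t, x s < 0))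

variable {H} {x y : ℝ → ℝ} {I : Set ℝ}

theorem Obeys.eventually_gt_of_ne {t : ℝ} (h : H.Obeys x y t) (ht : x t ≠ 0) :
    ∀ᶠ s in 𝓝[>] t, x t < x s := by
  rcases h with ⟨-, h, -⟩ | ⟨-, h, -⟩ | ⟨h, -⟩
  · exact h.eventually_gt_right (H.v.pos _)
  · exact h.eventually_gt_right (H.u.pos _)
  · exact absurd h ht

/-- The abscissa increases along trajectories. A trajectory cannot leave the second axis to the
left, as the abscissa increases on the left. -/
theorem strictMonoOn_of_obeys (ho : IsOpen I) (hI : I.OrdConnected) (hx : ContinuousOn x I)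
    (h : ∀ t ∈ I, H.Obeys x y t) : StrictMonoOn x I := by
  refine hx.strictMonoOn_of_eventually_gt hI fun t ht => ?_
  by_cases h0 : x t = 0
  · rcases h t ht with ⟨h1, -⟩ | ⟨h1, -⟩ | ⟨-, h1 | h1⟩
    · exact absurd h0 h1.ne
    · exact absurd h0 h1.ne'
    · rwa [h0]
    · exfalso
      have h2 := h1.and (mem_nhdsWithin_of_mem_nhds (ho.mem_nhds ht))
      obtain ⟨b, hb, hsub⟩ := (mem_nhdsGT_iff_exists_Ioo_subset).1 h2
      have hb : t < b := hb
      have hIoo : ∀ s ∈ Ioo t b, x s < 0 ∧ s ∈ I := fun s hs => hsub hs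
      have hIco : Ico t b ⊆ I := fun s hs => by
        rcases hs.1.eq_or_lt with rfl | h3
        · exact ht
        · exact (hIoo s ⟨h3, hs.2⟩).2
      have hmono : StrictMonoOn x (Ioo t b) :=
        (hx.mono fun s hs => (hIoo s hs).2).strictMonoOn_of_eventually_gt ordConnected_Ioo
          fun s hs => (h s (hIoo s hs).2).eventually_gt_of_ne (hIoo s hs).1.ne
      set c := (t + b) / 2 with hc
      have hcI : c ∈ Ioo t b := ⟨by linarith, by linarith⟩
      -- `x < x c < 0` just after `t`, which contradicts `x t = 0`
      have hlim : Tendsto x (𝓝[>] t) (𝓝 (x t)) :=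
        (hx.continuousAt (ho.mem_nhds ht)).tendsto.mono_left nhdsWithin_le_nhds
      have hle : x t ≤ x c := by
        refine le_of_tendsto hlim ?_
        filter_upwards [Ioo_mem_nhdsGT hcI.1] with s hs
        exact (hmono ⟨hs.1, hs.2.trans hcI.2⟩ hcI hs.2).le
      linarith [(hIoo c hcI).1]
  · exact (h t ht).eventually_gt_of_ne h0

/-- The first integral is constant along trajectories. -/
theorem W_eq_of_obeys (ho : IsOpen I) (hI : I.OrdConnected) (hx : ContinuousOn x I)
    (hy : ContinuousOn y I) (h : ∀ t ∈ I, H.Obeys x y t) {a b : ℝ} (ha : a ∈ I) (hb : b ∈ I) :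
    H.W (x a) (y a) = H.W (x b) (y b) := by
  have hmono := strictMonoOn_of_obeys ho hI hx h
  have hleft : ∀ a ∈ I, ∀ b ∈ I, a ≤ b → x b ≤ 0 → H.W (x a) (y a) = H.W (x b) (y b) := by
    intro a ha b hb hab hxb
    have hsub : Icc a b ⊆ I := hI.out ha hb
    rw [H.W_of_nonpos ((hmono.monotoneOn ha hb hab).trans hxb), H.W_of_nonpos hxb]
    have key : ∀ t ∈ Ioo a b, HasDerivAt x (H.v (x t, y t)) t ∧
        HasDerivAt y (H.v (x t, y t) * H.F (x t) (y t)) t := by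
      intro t ht
      have htI := hsub (Ioo_subset_Icc_self ht)
      have hneg : x t < 0 := (hmono htI hb ht.2).trans_le hxb
      rcases h t htI with ⟨-, h1⟩ | ⟨h1, -⟩ | ⟨h1, -⟩
      · exact h1
      · exact absurd h1 hneg.not_gt
      · exact absurd h1 hneg.ne
    exact H.F.Phi_eq_of_curve hab (hx.mono hsub) (hy.mono hsub) (fun t _ => H.v.abs_le _)
      (fun t ht => (key t ht).1) (fun t ht => (key t ht).2)
  have hright : ∀ a ∈ I, ∀ b ∈ I, a ≤ b → 0 ≤ x a → H.W (x a) (y a) = H.W (x b) (y b) := by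
    intro a ha b hb hab hxa
    have hsub : Icc a b ⊆ I := hI.out ha hb
    rw [H.W_of_nonneg hxa, H.W_of_nonneg (hxa.trans (hmono.monotoneOn ha hb hab))]
    have key : ∀ t ∈ Ioo a b, HasDerivAt x (H.u (x t, y t)) t ∧
        HasDerivAt y (H.u (x t, y t) * H.G (x t) (y t)) t := by
      intro t ht
      have htI := hsub (Ioo_subset_Icc_self ht)
      have hpos : 0 < x t := hxa.trans_lt (hmono ha htI ht.1)
      rcases h t htI with ⟨h1, -⟩ | ⟨-, h1⟩ | ⟨h1, -⟩
      · exact absurd h1 hpos.not_gt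
      · exact h1
      · exact absurd h1 hpos.ne'
    exact H.G.Phi_eq_of_curve hab (hx.mono hsub) (hy.mono hsub) (fun t _ => H.u.abs_le _)
      (fun t ht => (key t ht).1) (fun t ht => (key t ht).2)
  have hle : ∀ a ∈ I, ∀ b ∈ I, a ≤ b → H.W (x a) (y a) = H.W (x b) (y b) := by
    intro a ha b hb hab
    rcases le_or_gt (x b) 0 with hxb | hxb
    · exact hleft a ha b hb hab hxb
    rcases le_or_gt 0 (x a) with hxa | hxa
    · exact hright a ha b hb hab hxa
    have hsub : Icc a b ⊆ I := hI.out ha hb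
    obtain ⟨c, hc, hc0⟩ := intermediate_value_Icc hab (hx.mono hsub) ⟨hxa.le, hxb.le⟩
    exact (hleft a ha c (hsub hc) hc.1 hc0.le).trans (hright c (hsub hc) b hb hc.2 hc0.ge)
  rcases le_total a b with hab | hab
  · exact hle a ha b hb hab
  · exact (hle b hb a ha hab).symm

variable (H)

/-- The curve `(x, y)` is a trajectory of the concatenated flow that is on the second axis at the
time `0`. -/
structure IsCurve (x y : ℝ → ℝ) : Prop where
  contX : Continuous x
  contY : Continuous y
  zero : x 0 = 0
  left : ∀ s < 0, x s < 0 ∧ HasDerivAt x (H.v (x s, y s)) s ∧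
    HasDerivAt y (H.v (x s, y s) * H.F (x s) (y s)) s
  right : ∀ s > 0, 0 < x s ∧ HasDerivAt x (H.u (x s, y s)) s ∧
    HasDerivAt y (H.u (x s, y s) * H.G (x s) (y s)) s

/-- The level set `W = w` of the first integral, parametrized as a trajectory. -/
theorem exists_isCurve (w : ℝ) : ∃ T : ℝ ≃o ℝ, H.IsCurve T.symm fun s => H.V (T.symm s) w := by
  obtain ⟨T₁, h₁, d₁⟩ := H.v.exists_time (H.F.isSol_sol 0 w).continuous
  obtain ⟨T₂, h₂, d₂⟩ := H.u.exists_time (H.G.isSol_sol 0 w).continuous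
  set T := glueIso T₁ T₂ h₁ h₂ with hT
  have hT0 : T 0 = 0 := glueIso_zero h₁ h₂
  refine ⟨T, T.symm.continuous,
    H.continuous_V.comp (T.symm.continuous.prodMk continuous_const), OrderIso.symm_zero hT0,
    fun s hs => ?_, fun s hs => ?_⟩
  · have hev : T.symm =ᶠ[𝓝 s] T₁.symm := by
      filter_upwards [Iio_mem_nhds hs] with z hz using glueIso_symm_of_nonpos h₁ h₂ (le_of_lt hz)
    have hneg : T.symm s < 0 := by rwa [OrderIso.neg_of_neg (OrderIso.symm_zero hT0)]
    have hV := H.V_of_nonpos hneg.le w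
    have hx : HasDerivAt T.symm (H.v (T.symm s, H.V (T.symm s) w)) s := by
      rw [hV, hev.self_of_nhds]
      exact (d₁ s).congr_of_eventuallyEq hev
    refine ⟨hneg, hx, ?_⟩
    have hy := ((H.F.isSol_sol 0 w) (T.symm s)).comp s hx
    rw [mul_comm, ← hV] at hy
    refine hy.congr_of_eventuallyEq ?_
    filter_upwards [Iio_mem_nhds hs] with z hz
    refine H.V_of_nonpos ?_ w
    exact ((OrderIso.neg_of_neg (OrderIso.symm_zero hT0)).2 hz).le
  · have hev : T.symm =ᶠ[𝓝 s] T₂.symm := by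
      filter_upwards [Ioi_mem_nhds hs] with z hz using glueIso_symm_of_nonneg h₁ h₂ (le_of_lt hz)
    have hpos : 0 < T.symm s := by rwa [OrderIso.pos_of_pos (OrderIso.symm_zero hT0)]
    have hV := H.V_of_nonneg hpos.le w
    have hx : HasDerivAt T.symm (H.u (T.symm s, H.V (T.symm s) w)) s := by
      rw [hV, hev.self_of_nhds]
      exact (d₂ s).congr_of_eventuallyEq hev
    refine ⟨hpos, hx, ?_⟩
    have hy := ((H.G.isSol_sol 0 w) (T.symm s)).comp s hx
    rw [mul_comm, ← hV] at hy
    refine hy.congr_of_eventuallyEq ?_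
    filter_upwards [Ioi_mem_nhds hs] with z hz
    refine H.V_of_nonneg ?_ w
    exact ((OrderIso.pos_of_pos (OrderIso.symm_zero hT0)).2 hz).le

variable {H} in
/-- The image of a trajectory of `H` under the map that acts as `η` on abscissae and as `ω` on the
values of the first integrals is a trajectory of `H'`, up to an increasing change of time. -/
theorem exists_image (H' : HalfModel) (η ω : ℝ ≃o ℝ) (ho : IsOpen I) (hI : I.OrdConnected)
    (hx : ContinuousOn x I) (hy : ContinuousOn y I) (h : ∀ t ∈ I, H.Obeys x y t) :
    ∃ x' y' τ : ℝ → ℝ, H'.IsCurve x' y' ∧ StrictMonoOn τ I ∧ ContinuousOn τ I ∧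
      ∀ t ∈ I, x' (τ t) = η (x t) ∧ y' (τ t) = H'.V (η (x t)) (ω (H.W (x t) (y t))) := by
  rcases I.eq_empty_or_nonempty with rfl | ⟨t₀, ht₀⟩
  · obtain ⟨T, hT⟩ := H'.exists_isCurve 0
    exact ⟨_, _, id, hT, strictMonoOn_id, continuousOn_id, by simp⟩
  obtain ⟨T, hT⟩ := H'.exists_isCurve (ω (H.W (x t₀) (y t₀)))
  have hm := strictMonoOn_of_obeys ho hI hx h
  refine ⟨_, _, fun t => T (η (x t)), hT,
    fun _ ha _ hb hab => T.strictMono (η.strictMono (hm ha hb hab)),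
    (T.continuous.comp η.continuous).comp_continuousOn hx, fun t ht => ?_⟩
  simp [W_eq_of_obeys ho hI hx hy h ht ht₀]

/-- The homeomorphism of the plane that acts as `η` on abscissae and as `ω` on the values of the
first integrals. -/
noncomputable def transfer (H H' : HalfModel) (η ω : ℝ ≃o ℝ) : ℝ × ℝ ≃ₜ ℝ × ℝ :=
  H.straighten.trans ((η.toHomeomorph.prodCongr ω.toHomeomorph).trans H'.straighten.symm)

theorem transfer_apply (H H' : HalfModel) (η ω : ℝ ≃o ℝ) (p : ℝ × ℝ) :
    transfer H H' η ω p = (η p.1, H'.V (η p.1) (ω (H.W p.1 p.2))) := rfl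

theorem strictMono_transfer (H H' : HalfModel) (η ω : ℝ ≃o ℝ) (x : ℝ) :
    StrictMono fun y => (transfer H H' η ω (x, y)).2 := fun _ _ h =>
  H'.strictMono_V _ (ω.strictMono (H.strictMono_W x h))

end HalfModel

/-! ### The model of the piecewise smooth system -/

/-- A system on the plane in coordinates in which the second axis is crossed from left to right and
the first axis consists of sliding and escaping points: the field is `(vX, vX * FX)` where
`x y > 0`, with `FX < 0`, and `(vY, vY * FY)` where `x y < 0`, with `FY > 0`. The sliding velocity
is `S`. -/
structure FoldModel where
  FX : SlopeField
  FY : SlopeField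
  vX : Speed
  vY : Speed
  S : Speed
  l : ℝ
  l_pos : 0 < l
  FX_lt : ∀ x y, FX x y < -l
  lt_FY : ∀ x y, l < FY x y

namespace FoldModel

variable (N N' : FoldModel)

/-- The curve `(x, y)` obeys the model at the time `t`. -/
def Obeys (x y : ℝ → ℝ) (t : ℝ) : Prop :=
  (0 < x t * y t ∧ HasDerivAt x (N.vX (x t, y t)) t ∧
    HasDerivAt y (N.vX (x t, y t) * N.FX (x t) (y t)) t) ∨
  (x t * y t < 0 ∧ HasDerivAt x (N.vY (x t, y t)) t ∧
    HasDerivAt y (N.vY (x t, y t) * N.FY (x t) (y t)) t) ∨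
  (x t = 0 ∧ y t ≠ 0 ∧
    (((∀ᶠ s in 𝓝[<] t, 0 < x s * y s) ∧ (∀ᶠ s in 𝓝[>] t, x s * y s < 0)) ∨
      ((∀ᶠ s in 𝓝[<] t, x s * y s < 0) ∧ (∀ᶠ s in 𝓝[>] t, 0 < x s * y s)))) ∨
  (y t = 0 ∧ (∀ᶠ s in 𝓝 t, y s = 0) ∧ HasDerivAt x (N.S (x t, 0)) t)

/-- The arcs of trajectories of the model. -/
structure Traj (I : Set ℝ) (x y : ℝ → ℝ) : Prop where
  isOpen : IsOpen I
  ordConnected : I.OrdConnected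
  nonempty : I.Nonempty
  contX : ContinuousOn x I
  contY : ContinuousOn y I
  obeys : ∀ t ∈ I, N.Obeys x y t

/-- The flow on the upper half-plane. -/
def upper : HalfModel := ⟨N.FY, N.FX, N.vY, N.vX⟩

/-- The flow on the lower half-plane. -/
def lower : HalfModel := ⟨N.FX, N.FY, N.vX, N.vY⟩

variable {N} {I : Set ℝ} {x y : ℝ → ℝ}

/-- A trajectory that meets the first axis stays on it, and the others stay in a half-plane. -/
theorem Traj.trichotomy (h : N.Traj I x y) :
    (∀ t ∈ I, y t = 0) ∨ (∀ t ∈ I, 0 < y t) ∨ ∀ t ∈ I, y t < 0 := by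
  have hpre : IsPreconnected I := h.ordConnected.isPreconnected
  have hcont : ∀ t ∈ I, ContinuousAt y t := fun t ht =>
    h.contY.continuousAt (h.isOpen.mem_nhds ht)
  by_cases h0 : ∃ t ∈ I, y t = 0
  · left
    obtain ⟨t₀, ht₀, hy₀⟩ := h0
    have hu : IsOpen (interior {t | y t = 0}) := isOpen_interior
    have hv : IsOpen (interior {t | y t ≠ 0}) := isOpen_interior
    have hz : ∀ t ∈ I, y t = 0 → t ∈ interior {t | y t = 0} := by
      intro t ht hyt
      rw [mem_interior_iff_mem_nhds]
      rcases h.obeys t ht with ⟨h1, -⟩ | ⟨h1, -⟩ | ⟨-, h1, -⟩ | ⟨-, h1, -⟩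
      · simp [hyt] at h1
      · simp [hyt] at h1
      · exact absurd hyt h1
      · exact h1
    have := hpre.subset_left_of_subset_union hu hv
      (disjoint_left.2 fun t h1 h2 =>
        absurd (interior_subset (s := {t | y t = 0}) h1) (interior_subset (s := {t | y t ≠ 0}) h2))
      (fun t ht => by
        by_cases hyt : y t = 0
        · exact Or.inl (hz t ht hyt)
        · right
          rw [mem_interior_iff_mem_nhds]
          exact (hcont t ht).eventually_ne hyt) ⟨t₀, ht₀, hz t₀ ht₀ hy₀⟩
    exact fun t ht => interior_subset (s := {t | y t = 0}) (this ht)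
  · right
    push Not at h0
    by_cases hp : ∃ t ∈ I, 0 < y t
    · left
      obtain ⟨a, ha, hya⟩ := hp
      intro t ht
      by_contra! hle
      obtain ⟨z, hz, hz0⟩ := hpre.intermediate_value ht ha h.contY ⟨hle, hya.le⟩
      exact h0 z hz hz0
    · right
      push Not at hp
      exact fun t ht => lt_of_le_of_ne (hp t ht) (h0 t ht)

theorem Obeys.upper {t : ℝ} (h : N.Obeys x y t) (hy : ContinuousAt y t) (hp : 0 < y t) :
    N.upper.Obeys x y t := by
  rcases h with ⟨h1, h2⟩ | ⟨h1, h2⟩ | ⟨h1, -, h2⟩ | ⟨h1, -⟩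
  · exact Or.inr (Or.inl ⟨pos_of_mul_pos_left h1 hp.le, h2⟩)
  · exact Or.inl ⟨neg_of_mul_neg_left h1 hp.le, h2⟩
  · refine Or.inr (Or.inr ⟨h1, ?_⟩)
    have hev : ∀ᶠ s in 𝓝[>] t, 0 < y s := nhdsWithin_le_nhds (hy.eventually (lt_mem_nhds hp))
    rcases h2 with ⟨-, h2⟩ | ⟨-, h2⟩
    · right
      filter_upwards [hev, h2] with s h3 h4 using neg_of_mul_neg_left h4 h3.le
    · left
      filter_upwards [hev, h2] with s h3 h4 using pos_of_mul_pos_left h4 h3.le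
  · exact absurd h1 hp.ne'

theorem Obeys.lower {t : ℝ} (h : N.Obeys x y t) (hy : ContinuousAt y t) (hn : y t < 0) :
    N.lower.Obeys x y t := by
  rcases h with ⟨h1, h2⟩ | ⟨h1, h2⟩ | ⟨h1, -, h2⟩ | ⟨h1, -⟩
  · exact Or.inl ⟨neg_of_mul_pos_left h1 hn.le, h2⟩
  · exact Or.inr (Or.inl ⟨pos_of_mul_neg_left h1 hn.le, h2⟩)
  · refine Or.inr (Or.inr ⟨h1, ?_⟩)
    have hev : ∀ᶠ s in 𝓝[>] t, y s < 0 := nhdsWithin_le_nhds (hy.eventually (gt_mem_nhds hn))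
    rcases h2 with ⟨-, h2⟩ | ⟨-, h2⟩
    · left
      filter_upwards [hev, h2] with s h3 h4 using pos_of_mul_neg_left h4 h3.le
    · right
      filter_upwards [hev, h2] with s h3 h4 using neg_of_mul_pos_left h4 h3.le
  · exact absurd h1 hn.ne

theorem obeys_of_upper (h : N.upper.IsCurve x y) {s : ℝ} (hp : 0 < y s) : N.Obeys x y s := by
  rcases lt_trichotomy s 0 with hs | rfl | hs
  · obtain ⟨h1, h2⟩ := h.left s hs
    exact Or.inr (Or.inl ⟨mul_neg_of_neg_of_pos h1 hp, h2⟩)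
  · have hev : ∀ᶠ s in 𝓝 (0 : ℝ), 0 < y s := h.contY.continuousAt.eventually (lt_mem_nhds hp)
    refine Or.inr (Or.inr (Or.inl ⟨h.zero, hp.ne', Or.inr ⟨?_, ?_⟩⟩))
    · filter_upwards [nhdsWithin_le_nhds hev, self_mem_nhdsWithin] with z hz hz0
      exact mul_neg_of_neg_of_pos (h.left z hz0).1 hz
    · filter_upwards [nhdsWithin_le_nhds hev, self_mem_nhdsWithin] with z hz hz0
      exact mul_pos (h.right z hz0).1 hz
  · obtain ⟨h1, h2⟩ := h.right s hs
    exact Or.inl ⟨mul_pos h1 hp, h2⟩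

theorem obeys_of_lower (h : N.lower.IsCurve x y) {s : ℝ} (hn : y s < 0) : N.Obeys x y s := by
  rcases lt_trichotomy s 0 with hs | rfl | hs
  · obtain ⟨h1, h2⟩ := h.left s hs
    exact Or.inl ⟨mul_pos_of_neg_of_neg h1 hn, h2⟩
  · have hev : ∀ᶠ s in 𝓝 (0 : ℝ), y s < 0 := h.contY.continuousAt.eventually (gt_mem_nhds hn)
    refine Or.inr (Or.inr (Or.inl ⟨h.zero, hn.ne, Or.inl ⟨?_, ?_⟩⟩))
    · filter_upwards [nhdsWithin_le_nhds hev, self_mem_nhdsWithin] with z hz hz0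
      exact mul_pos_of_neg_of_neg (h.left z hz0).1 hz
    · filter_upwards [nhdsWithin_le_nhds hev, self_mem_nhdsWithin] with z hz hz0
      exact mul_neg_of_pos_of_neg (h.right z hz0).1 hz
  · obtain ⟨h1, h2⟩ := h.right s hs
    exact Or.inr (Or.inl ⟨mul_neg_of_pos_of_neg h1 hn, h2⟩)

/-- `h` sends the trajectories of `N` to those of `N'`, up to an increasing change of time. -/
def Sends (N N' : FoldModel) (h : ℝ × ℝ → ℝ × ℝ) : Prop :=
  ∀ (I : Set ℝ) (x y : ℝ → ℝ), N.Traj I x y → ∃ (I' : Set ℝ) (x' y' τ : ℝ → ℝ),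
    N'.Traj I' x' y' ∧ StrictMonoOn τ I ∧ ContinuousOn τ I ∧ τ '' I = I' ∧
      ∀ t ∈ I, h (x t, y t) = (x' (τ t), y' (τ t))

/-- `h` acts as `η` on the abscissae, preserves the sign of the ordinate, and maps the level sets of
the first integrals of `N` in both half-planes to those of `N'`. -/
structure Matches (N N' : FoldModel) (h : ℝ × ℝ → ℝ × ℝ) (η : ℝ ≃o ℝ) : Prop where
  zero : η 0 = 0
  fst : ∀ p, (h p).1 = η p.1
  pos : ∀ p, 0 < (h p).2 ↔ 0 < p.2
  neg : ∀ p, (h p).2 < 0 ↔ p.2 < 0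
  upper : ∃ ω : ℝ ≃o ℝ, ∀ p : ℝ × ℝ, 0 < p.2 → N'.upper.W (h p).1 (h p).2 = ω (N.upper.W p.1 p.2)
  lower : ∃ ω : ℝ ≃o ℝ, ∀ p : ℝ × ℝ, p.2 < 0 → N'.lower.W (h p).1 (h p).2 = ω (N.lower.W p.1 p.2)

theorem Matches.symm {N' : FoldModel} {h : ℝ × ℝ ≃ₜ ℝ × ℝ} {η : ℝ ≃o ℝ}
    (H : Matches N N' h η) : Matches N' N h.symm η.symm where
  zero := OrderIso.symm_zero H.zero
  fst p := by
    have := H.fst (h.symm p)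
    rw [h.apply_symm_apply] at this
    rw [this, η.symm_apply_apply]
  pos p := by rw [← H.pos, h.apply_symm_apply]
  neg p := by rw [← H.neg, h.apply_symm_apply]
  upper := by
    obtain ⟨ω, hω⟩ := H.upper
    refine ⟨ω.symm, fun p hp => ?_⟩
    have := hω (h.symm p) (by rwa [← H.pos, h.apply_symm_apply])
    rw [h.apply_symm_apply] at this
    rw [this, ω.symm_apply_apply]
  lower := by
    obtain ⟨ω, hω⟩ := H.lower
    refine ⟨ω.symm, fun p hp => ?_⟩
    have := hω (h.symm p) (by rwa [← H.neg, h.apply_symm_apply])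
    rw [h.apply_symm_apply] at this
    rw [this, ω.symm_apply_apply]

theorem Matches.sends {N' : FoldModel} {h : ℝ × ℝ → ℝ × ℝ} {η : ℝ ≃o ℝ} (H : Matches N N' h η) :
    Sends N N' h := by
  intro I x y hT
  have hcont : ∀ t ∈ I, ContinuousAt y t := fun t ht =>
    hT.contY.continuousAt (hT.isOpen.mem_nhds ht)
  rcases hT.trichotomy with h0 | hpos | hneg
  · have hd : ∀ t ∈ I, HasDerivAt x (N.S (x t, 0)) t := by
      intro t ht
      rcases hT.obeys t ht with ⟨h1, -⟩ | ⟨h1, -⟩ | ⟨-, h1, -⟩ | ⟨-, -, h1⟩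
      · simp [h0 t ht] at h1
      · simp [h0 t ht] at h1
      · exact absurd (h0 t ht) h1
      · exact h1
    have hm := hT.contX.strictMonoOn_of_eventually_gt hT.ordConnected
      fun t ht => (hd t ht).eventually_gt_right (N.S.pos _)
    obtain ⟨T, hT0, dT⟩ := N'.S.exists_time (g := fun _ => 0) continuous_const
    have hτ : StrictMonoOn (fun t => T (η (x t))) I := fun _ ha _ hb hab =>
      T.strictMono (η.strictMono (hm ha hb hab))
    have hτc : ContinuousOn (fun t => T (η (x t))) I :=
      (T.continuous.comp η.continuous).comp_continuousOn hT.contX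
    refine ⟨_, T.symm, fun _ => 0, _, ⟨hτ.isOpen_image hτc hT.isOpen hT.ordConnected,
      hτc.ordConnected_image hT.ordConnected, hT.nonempty.image _, T.symm.continuous.continuousOn,
      continuousOn_const, fun s _ => Or.inr (Or.inr (Or.inr ⟨rfl, Eventually.of_forall fun _ => rfl,
        dT s⟩))⟩, hτ, hτc, rfl, fun t ht => ?_⟩
    refine Prod.ext ?_ ?_
    · simp [H.fst]
    · have h1 := H.pos (x t, y t)
      have h2 := H.neg (x t, y t)
      simp only [h0 t ht, lt_irrefl, iff_false] at h1 h2 ⊢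
      exact le_antisymm (not_lt.1 h1) (not_lt.1 h2)
  · have hob : ∀ t ∈ I, N.upper.Obeys x y t := fun t ht =>
      (hT.obeys t ht).upper (hcont t ht) (hpos t ht)
    obtain ⟨ω, hω⟩ := H.upper
    obtain ⟨x', y', τ, hc, hτ, hτc, himg⟩ := HalfModel.exists_image N'.upper η ω hT.isOpen
      hT.ordConnected hT.contX hT.contY hob
    have heq : ∀ t ∈ I, h (x t, y t) = (x' (τ t), y' (τ t)) := fun t ht => by
      rw [(himg t ht).1, (himg t ht).2, ← hω (x t, y t) (hpos t ht), ← H.fst (x t, y t),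
        HalfModel.V_W]
    refine ⟨_, x', y', τ, ⟨hτ.isOpen_image hτc hT.isOpen hT.ordConnected,
      hτc.ordConnected_image hT.ordConnected, hT.nonempty.image _, hc.contX.continuousOn,
      hc.contY.continuousOn, ?_⟩, hτ, hτc, rfl, heq⟩
    rintro _ ⟨t, ht, rfl⟩
    refine obeys_of_upper hc ?_
    have := (H.pos (x t, y t)).2 (hpos t ht)
    rwa [heq t ht] at this
  · have hob : ∀ t ∈ I, N.lower.Obeys x y t := fun t ht =>
      (hT.obeys t ht).lower (hcont t ht) (hneg t ht)
    obtain ⟨ω, hω⟩ := H.lower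
    obtain ⟨x', y', τ, hc, hτ, hτc, himg⟩ := HalfModel.exists_image N'.lower η ω hT.isOpen
      hT.ordConnected hT.contX hT.contY hob
    have heq : ∀ t ∈ I, h (x t, y t) = (x' (τ t), y' (τ t)) := fun t ht => by
      rw [(himg t ht).1, (himg t ht).2, ← hω (x t, y t) (hneg t ht), ← H.fst (x t, y t),
        HalfModel.V_W]
    refine ⟨_, x', y', τ, ⟨hτ.isOpen_image hτc hT.isOpen hT.ordConnected,
      hτc.ordConnected_image hT.ordConnected, hT.nonempty.image _, hc.contX.continuousOn,
      hc.contY.continuousOn, ?_⟩, hτ, hτc, rfl, heq⟩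
    rintro _ ⟨t, ht, rfl⟩
    refine obeys_of_lower hc ?_
    have := (H.neg (x t, y t)).2 (hneg t ht)
    rwa [heq t ht] at this

variable (N)

/-- The first integral of `X` on the first axis. -/
noncomputable def phiX : ℝ ≃o ℝ :=
  (N.FX.strictMono_Phi_axis fun x y => (N.FX_lt x y).trans (neg_neg_of_pos N.l_pos)
    ).orderIsoOfSurjective _
      (N.FX.surjective_Phi_axis_of_gt (neg_neg_of_pos N.l_pos) N.FX_lt)

/-- The first integral of `Y` on the first axis, with the sign changed. -/
noncomputable def phiY : ℝ ≃o ℝ :=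
  StrictMono.orderIsoOfSurjective (fun x => -N.FY.Phi x 0)
    (fun _ _ h => neg_lt_neg (N.FY.strictAnti_Phi_axis (fun x y => N.l_pos.trans (N.lt_FY x y)) h))
    (neg_surjective.comp (N.FY.surjective_Phi_axis_of_lt N.l_pos N.lt_FY))

theorem phiX_apply (x : ℝ) : N.phiX x = N.FX.Phi x 0 := rfl
theorem phiY_apply (x : ℝ) : N.phiY x = -N.FY.Phi x 0 := rfl
theorem phiX_zero : N.phiX 0 = 0 := by simp [phiX_apply]
theorem phiY_zero : N.phiY 0 = 0 := by simp [phiY_apply]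

/-- The field `Y` is steeper than `X`, with a slope `κ` in between. -/
def Steep (κ : ℝ) : Prop := ∀ x y, -κ < N.FX x y ∧ κ < N.FY x y

/-- The field `Y` is less steep than `X`, with a slope `κ` in between. -/
def Flat (κ : ℝ) : Prop := ∀ x y, N.FX x y < -κ ∧ N.FY x y < κ

variable {N}

theorem Steep.separated {κ : ℝ} (h : N.Steep κ) : Separated κ N.phiX N.phiY := by
  intro x
  simp only [phiX_apply, phiY_apply]
  refine ⟨fun hx => ⟨?_, ?_⟩, fun hx => ⟨?_, ?_⟩⟩
  · simpa using N.FX.Phi_axis_lt (fun x y => (h x y).1) hx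
  · linarith [N.FY.Phi_axis_lt (fun x y => (h x y).2) hx]
  · simpa using N.FX.lt_Phi_axis (fun x y => (h x y).1) hx
  · linarith [N.FY.lt_Phi_axis (fun x y => (h x y).2) hx]

theorem Flat.separated {κ : ℝ} (h : N.Flat κ) : Separated κ N.phiY N.phiX := by
  intro x
  simp only [phiX_apply, phiY_apply]
  refine ⟨fun hx => ⟨?_, ?_⟩, fun hx => ⟨?_, ?_⟩⟩
  · linarith [N.FY.lt_Phi_axis' (fun x y => (h x y).2) hx]
  · simpa using N.FX.lt_Phi_axis' (fun x y => (h x y).1) hx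
  · linarith [N.FY.Phi_axis_lt' (fun x y => (h x y).2) hx]
  · simpa using N.FX.Phi_axis_lt' (fun x y => (h x y).1) hx

variable (N)

theorem upper_W_axis (x : ℝ) :
    N.upper.W x 0 = |glueIso N.phiY N.phiX N.phiY_zero N.phiX_zero x| := by
  rcases le_total x 0 with hx | hx
  · rw [HalfModel.W_of_nonpos _ hx, glueIso_of_nonpos _ _ hx,
      abs_of_nonpos (N.phiY_zero ▸ N.phiY.monotone hx), phiY_apply, neg_neg]
    rfl
  · rw [HalfModel.W_of_nonneg _ hx, glueIso_of_nonneg _ _ hx,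
      abs_of_nonneg (N.phiX_zero ▸ N.phiX.monotone hx), phiX_apply]
    rfl

theorem lower_W_axis (x : ℝ) :
    N.lower.W x 0 = -|glueIso N.phiX N.phiY N.phiX_zero N.phiY_zero x| := by
  rcases le_total x 0 with hx | hx
  · rw [HalfModel.W_of_nonpos _ hx, glueIso_of_nonpos _ _ hx,
      abs_of_nonpos (N.phiX_zero ▸ N.phiX.monotone hx), phiX_apply, neg_neg]
    rfl
  · rw [HalfModel.W_of_nonneg _ hx, glueIso_of_nonneg _ _ hx,
      abs_of_nonneg (N.phiY_zero ▸ N.phiY.monotone hx), phiY_apply, neg_neg]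
    rfl

end FoldModel

theorem OrderIso.apply_abs_of_odd {ω : ℝ ≃o ℝ} (h : ∀ x, ω (-x) = -ω x) (x : ℝ) :
    ω |x| = |ω x| := by
  have h0 : ω 0 = 0 := by
    have := h 0
    rw [neg_zero] at this
    linarith
  rcases le_total x 0 with hx | hx
  · rw [abs_of_nonpos hx, h, abs_of_nonpos (h0 ▸ ω.monotone hx)]
  · rw [abs_of_nonneg hx, abs_of_nonneg (h0 ▸ ω.monotone hx)]

theorem HalfModel.transfer_axis {H H' : HalfModel} {η ω : ℝ ≃o ℝ} {x : ℝ}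
    (h : ω (H.W x 0) = H'.W (η x) 0) : transfer H H' η ω (x, 0) = (η x, 0) := by
  rw [transfer_apply]
  simp only
  rw [h, V_W]

/-- Gluing along the first axis of two homeomorphisms of the plane that preserve the half-planes. -/
theorem Homeomorph.exists_glue {e₁ e₂ : ℝ × ℝ ≃ₜ ℝ × ℝ}
    (h : ∀ x, e₁ (x, 0) = e₂ (x, 0)) (h₁ : ∀ p, (e₁ p).2 ≤ 0 ↔ p.2 ≤ 0)
    (h₁' : ∀ p, (e₁ p).2 < 0 ↔ p.2 < 0) (h₂ : ∀ p, (e₂ p).2 ≤ 0 ↔ p.2 ≤ 0) :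
    ∃ e : ℝ × ℝ ≃ₜ ℝ × ℝ, (∀ p, p.2 ≤ 0 → e p = e₁ p) ∧ ∀ p, 0 < p.2 → e p = e₂ p := by
  have hax : ∀ p : ℝ × ℝ, p.2 = 0 → e₁ p = e₂ p := by
    rintro ⟨x, y⟩ (rfl : y = 0); exact h x
  have hax' : ∀ q : ℝ × ℝ, q.2 = 0 → e₁.symm q = e₂.symm q := by
    intro q hq
    have h3 : (e₁.symm q).2 = 0 := by
      refine le_antisymm ?_ ?_
      · rw [← h₁, e₁.apply_symm_apply, hq]
      · rw [← not_lt, ← h₁', e₁.apply_symm_apply, hq]; exact lt_irrefl _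
    rw [eq_comm, e₂.symm_apply_eq, ← hax _ h3, e₁.apply_symm_apply]
  let e : ℝ × ℝ ≃ₜ ℝ × ℝ :=
    { toFun := fun p => if p.2 ≤ 0 then e₁ p else e₂ p
      invFun := fun q => if q.2 ≤ 0 then e₁.symm q else e₂.symm q
      left_inv := fun p => by
        by_cases hp : p.2 ≤ 0
        · simp [hp, (h₁ p).2 hp]
        · simp [hp, h₂ p]
      right_inv := fun q => by
        have k₁ := h₁ (e₁.symm q)
        have k₂ := h₂ (e₂.symm q)
        rw [e₁.apply_symm_apply] at k₁
        rw [e₂.apply_symm_apply] at k₂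
        by_cases hq : q.2 ≤ 0
        · simp [hq, k₁.1 hq]
        · simp [hq, ← k₂]
      continuous_toFun := e₁.continuous.if_le e₂.continuous continuous_snd continuous_const hax
      continuous_invFun :=
        e₁.symm.continuous.if_le e₂.symm.continuous continuous_snd continuous_const hax' }
  exact ⟨e, fun p hp => if_pos hp, fun p hp => if_neg (not_le.2 hp)⟩

/-- The equivalence of two models on the same side: it is glued from the transfer maps of the two
half-planes, which agree on the first axis by the choice of `η`. -/
theorem FoldModel.exists_matches (N N' : FoldModel) {κ κ' : ℝ} (hκ : 0 < κ) (hκ' : 0 < κ')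
    (h : (N.Steep κ ∧ N'.Steep κ') ∨ (N.Flat κ ∧ N'.Flat κ')) :
    ∃ (e : ℝ × ℝ ≃ₜ ℝ × ℝ) (η : ℝ ≃o ℝ), Matches N N' e η := by
  obtain ⟨η, ωA, ωB, h0, oA, oB, hA, hB⟩ := exists_conjugacy_of_separated hκ hκ' N.phiX_zero
    N.phiY_zero N'.phiX_zero N'.phiY_zero
    (h.imp (fun h => ⟨h.1.separated, h.2.separated⟩) fun h => ⟨h.1.separated, h.2.separated⟩)
  set e₁ := HalfModel.transfer N.lower N'.lower η ωB with he₁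
  set e₂ := HalfModel.transfer N.upper N'.upper η ωA with he₂
  have a₁ : ∀ x, e₁ (x, 0) = (η x, 0) := fun x => HalfModel.transfer_axis <| by
    rw [lower_W_axis, lower_W_axis, oB, OrderIso.apply_abs_of_odd oB, hB]
  have a₂ : ∀ x, e₂ (x, 0) = (η x, 0) := fun x => HalfModel.transfer_axis <| by
    rw [upper_W_axis, upper_W_axis, OrderIso.apply_abs_of_odd oA, hA]
  have n₁ : ∀ p, ((e₁ p).2 < 0 ↔ p.2 < 0) := by
    rintro ⟨x, y⟩
    have := (HalfModel.strictMono_transfer N.lower N'.lower η ωB x).lt_iff_lt (a := y) (b := 0)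
    simp only [← he₁, a₁] at this
    exact this
  have p₁ : ∀ p, ((e₁ p).2 ≤ 0 ↔ p.2 ≤ 0) := by
    rintro ⟨x, y⟩
    have := (HalfModel.strictMono_transfer N.lower N'.lower η ωB x).le_iff_le (a := y) (b := 0)
    simp only [← he₁, a₁] at this
    exact this
  have p₂ : ∀ p, ((e₂ p).2 ≤ 0 ↔ p.2 ≤ 0) := by
    rintro ⟨x, y⟩
    have := (HalfModel.strictMono_transfer N.upper N'.upper η ωA x).le_iff_le (a := y) (b := 0)
    simp only [← he₂, a₂] at this
    exact this
  obtain ⟨e, hlow, hup⟩ := Homeomorph.exists_glue (e₁ := e₁) (e₂ := e₂)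
    (fun x => (a₁ x).trans (a₂ x).symm) p₁ n₁ p₂
  have hle : ∀ p, ((e p).2 ≤ 0 ↔ p.2 ≤ 0) := by
    intro p
    rcases le_or_gt p.2 0 with hp | hp
    · rw [hlow p hp]; exact p₁ p
    · rw [hup p hp]; exact p₂ p
  refine ⟨e, η, h0, fun p => ?_, fun p => ?_, fun p => ?_, ⟨ωA, fun p hp => ?_⟩,
    ⟨ωB, fun p hp => ?_⟩⟩
  · rcases le_or_gt p.2 0 with hp | hp
    · rw [hlow p hp]; rfl
    · rw [hup p hp]; rfl
  · rw [← not_le, ← not_le, hle]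
  · rcases le_or_gt p.2 0 with hp | hp
    · rw [hlow p hp]; exact n₁ p
    · have := (not_congr (hle p)).2 (not_le.2 hp)
      constructor <;> intro h3 <;> linarith
  · rw [hup p hp, he₂, HalfModel.transfer_apply, HalfModel.W_V]
  · rw [hlow p hp.le, he₁, HalfModel.transfer_apply, HalfModel.W_V]

/-! ### Adapted coordinates -/

theorem otherIdx_ne (i : Fin 2) : otherIdx i ≠ i := by
  fin_cases i <;> simp [otherIdx]

theorem otherIdx_otherIdx (i : Fin 2) : otherIdx (otherIdx i) = i := by
  simp [otherIdx]

theorem eq_or_eq_otherIdx (i k : Fin 2) : k = i ∨ k = otherIdx i := by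
  fin_cases i <;> fin_cases k <;> simp [otherIdx]

theorem mul_otherIdx (p : Plane) (i : Fin 2) : p 0 * p 1 = p i * p (otherIdx i) := by
  fin_cases i <;> simp [otherIdx, mul_comm]

/-- The coordinates `(s p_i, s p_j)` with `j ≠ i`, for a sign `s`. -/
def signedCoord (i : Fin 2) {s : ℝ} (hs : s * s = 1) : Plane ≃ₜ ℝ × ℝ where
  toFun p := (s * p i, s * p (otherIdx i))
  invFun q k := if k = i then s * q.1 else s * q.2
  left_inv p := by
    ext k
    rcases eq_or_eq_otherIdx i k with rfl | rfl
    · simp [← mul_assoc, hs]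
    · simp [otherIdx_ne, ← mul_assoc, hs]
  right_inv q := by simp [otherIdx_ne, ← mul_assoc, hs]
  continuous_toFun := by fun_prop
  continuous_invFun := by
    refine continuous_pi fun k => ?_
    split_ifs <;> fun_prop

section signedCoord

variable {i : Fin 2} {s : ℝ} (hs : s * s = 1)

theorem signedCoord_apply (p : Plane) :
    signedCoord i hs p = (s * p i, s * p (otherIdx i)) := rfl

theorem signedCoord_symm_self (q : ℝ × ℝ) : (signedCoord i hs).symm q i = s * q.1 := if_pos rfl

theorem signedCoord_symm_other (q : ℝ × ℝ) :
    (signedCoord i hs).symm q (otherIdx i) = s * q.2 := if_neg (otherIdx_ne i)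

include hs in
theorem abs_eq_one_of_mul_self : |s| = 1 := by
  rcases mul_self_eq_one_iff.1 hs with rfl | rfl <;> simp

/-- The retraction of the plane onto a square, read in the coordinates `signedCoord`. -/
noncomputable def clampCoord (i : Fin 2) {s : ℝ} (hs : s * s = 1) (δ : ℝ) (q : ℝ × ℝ) : Plane :=
  (signedCoord i hs).symm (max (-δ) (min δ q.1), max (-δ) (min δ q.2))

theorem continuous_clampCoord (δ : ℝ) : Continuous (clampCoord i hs δ) :=
  (signedCoord i hs).symm.continuous.comp (by fun_prop)

theorem abs_clamp_le {δ : ℝ} (hδ : 0 ≤ δ) (x : ℝ) : |max (-δ) (min δ x)| ≤ δ :=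
  abs_le.2 ⟨le_max_left _ _, max_le (by linarith) (min_le_left _ _)⟩

theorem clampCoord_mem {δ : ℝ} (hδ : 0 ≤ δ) (q : ℝ × ℝ) :
    clampCoord i hs δ q ∈ Metric.closedBall (0 : Plane) δ := by
  rw [mem_closedBall_zero_iff, pi_norm_le_iff_of_nonneg hδ]
  intro k
  rcases eq_or_eq_otherIdx i k with rfl | rfl
  · rw [clampCoord, signedCoord_symm_self, Real.norm_eq_abs, abs_mul, abs_eq_one_of_mul_self hs,
      one_mul]
    exact abs_clamp_le hδ _
  · rw [clampCoord, signedCoord_symm_other, Real.norm_eq_abs, abs_mul, abs_eq_one_of_mul_self hs,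
      one_mul]
    exact abs_clamp_le hδ _

theorem clampCoord_signedCoord {δ : ℝ} {p : Plane} (hp : p ∈ Metric.closedBall (0 : Plane) δ) :
    clampCoord i hs δ (signedCoord i hs p) = p := by
  have hc : ∀ k, max (-δ) (min δ (s * p k)) = s * p k := fun k => by
    have h1 : |s * p k| ≤ δ := by
      rw [abs_mul, abs_eq_one_of_mul_self hs, one_mul, ← Real.norm_eq_abs]
      exact (norm_le_pi_norm p k).trans (mem_closedBall_zero_iff.1 hp)
    rw [min_eq_right (abs_le.1 h1).2, max_eq_right (abs_le.1 h1).1]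
  rw [clampCoord, signedCoord_apply, hc, hc, ← signedCoord_apply hs, Homeomorph.symm_apply_apply]

theorem dist_clampCoord_le (δ x y y' : ℝ) :
    dist (clampCoord i hs δ (x, y)) (clampCoord i hs δ (x, y')) ≤ |y - y'| := by
  rw [dist_pi_le_iff (abs_nonneg _)]
  intro k
  rcases eq_or_eq_otherIdx i k with rfl | rfl
  · simp [clampCoord, signedCoord_symm_self]
  · rw [clampCoord, clampCoord, signedCoord_symm_other, signedCoord_symm_other, Real.dist_eq,
      ← mul_sub, abs_mul, abs_eq_one_of_mul_self hs, one_mul]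
    calc _ = |max (min δ y) (-δ) - max (min δ y') (-δ)| := by simp only [max_comm]
      _ ≤ |min δ y - min δ y'| := abs_max_sub_max_le_abs _ _ _
      _ ≤ max |δ - δ| |y - y'| := abs_min_sub_min_le_max _ _ _ _
      _ = |y - y'| := by simp

/-- The extension of a positive Lipschitz function from a square to the plane. -/
noncomputable def clampSpeed (i : Fin 2) {s : ℝ} (hs : s * s = 1) {δ : ℝ} (hδ : 0 ≤ δ)
    {f : Plane → ℝ} {K : NNReal} (hf : LipschitzOnWith K f (Metric.closedBall 0 δ)) {lo hi : ℝ}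
    (h0 : 0 < lo) (hb : ∀ p ∈ Metric.closedBall (0 : Plane) δ, lo ≤ f p ∧ f p ≤ hi) : Speed where
  toFun q := f (clampCoord i hs δ q)
  continuous_toFun :=
    hf.continuousOn.comp_continuous (continuous_clampCoord hs δ) (clampCoord_mem hs hδ)
  lo := lo
  hi := hi
  lo_pos := h0
  lo_le q := (hb _ (clampCoord_mem hs hδ q)).1
  le_hi q := (hb _ (clampCoord_mem hs hδ q)).2

/-- The extension of a Lipschitz slope from a square to the plane. -/
noncomputable def clampSlope (i : Fin 2) {s : ℝ} (hs : s * s = 1) {δ : ℝ} (hδ : 0 ≤ δ)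
    {f : Plane → ℝ} {K : NNReal} (hf : LipschitzOnWith K f (Metric.closedBall 0 δ)) {M : NNReal}
    (hb : ∀ p ∈ Metric.closedBall (0 : Plane) δ, |f p| ≤ M) : SlopeField where
  toFun x y := f (clampCoord i hs δ (x, y))
  continuous_toFun :=
    hf.continuousOn.comp_continuous (continuous_clampCoord hs δ) (clampCoord_mem hs hδ)
  K := K
  lipschitz x := LipschitzWith.of_dist_le_mul fun y y' =>
    (hf.dist_le_mul _ (clampCoord_mem hs hδ _) _ (clampCoord_mem hs hδ _)).trans
      (mul_le_mul_of_nonneg_left (dist_clampCoord_le hs δ x y y') K.2)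
  M := M
  bound _ _ := hb _ (clampCoord_mem hs hδ _)

end signedCoord

/-! ### Local models of piecewise smooth systems -/

namespace PWSystem

variable {r : WithTop ℕ∞} (Z : PWSystem r)

/-- In the coordinates `(s p_i, s p_j)` the system is transversal to the axes at the origin: `X`
points to the right and down, and `Y` to the right and up. -/
structure Adapted (i : Fin 2) (s : ℝ) : Prop where
  mul_self : s * s = 1
  X_pos : 0 < s * Z.X 0 i
  X_neg : s * Z.X 0 (otherIdx i) < 0
  Y_pos : 0 < s * Z.Y 0 i
  Y_pos' : 0 < s * Z.Y 0 (otherIdx i)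

/-- On the ball of radius `δ` around the origin the system is given by the model `N` in the
coordinates `(s p_i, s p_j)`. -/
structure Represents (i : Fin 2) (s : ℝ) (N : FoldModel) (δ : ℝ) : Prop where
  mul_self : s * s = 1
  pos : 0 < δ
  ball_subset : Metric.ball 0 δ ⊆ Z.U
  X_fst : ∀ p ∈ Metric.ball (0 : Plane) δ,
    s * Z.X p i = N.vX (s * p i, s * p (otherIdx i))
  X_snd : ∀ p ∈ Metric.ball (0 : Plane) δ, s * Z.X p (otherIdx i) =
    N.vX (s * p i, s * p (otherIdx i)) * N.FX (s * p i) (s * p (otherIdx i))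
  Y_fst : ∀ p ∈ Metric.ball (0 : Plane) δ,
    s * Z.Y p i = N.vY (s * p i, s * p (otherIdx i))
  Y_snd : ∀ p ∈ Metric.ball (0 : Plane) δ, s * Z.Y p (otherIdx i) =
    N.vY (s * p i, s * p (otherIdx i)) * N.FY (s * p i) (s * p (otherIdx i))
  sliding : ∀ p ∈ Metric.ball (0 : Plane) δ, s * Z.slidingField (otherIdx i) p =
    N.S (s * p i, s * p (otherIdx i))

/-- The Lipschitz bound of a `C¹` function on all small balls. -/
theorem _root_.ContDiffAt.exists_lipschitzOnWith_closedBall {f : Plane → ℝ}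
    (hf : ContDiffAt ℝ 1 f 0) :
    ∃ K, ∀ᶠ δ in 𝓝[>] (0 : ℝ), LipschitzOnWith K f (Metric.closedBall 0 δ) := by
  obtain ⟨K, t, ht, hK⟩ := hf.exists_lipschitzOnWith
  obtain ⟨ε, hε, hsub⟩ := Metric.nhds_basis_closedBall.mem_iff.1 ht
  refine ⟨K, ?_⟩
  filter_upwards [Ioc_mem_nhdsGT hε] with δ hδ
  exact hK.mono ((Metric.closedBall_subset_closedBall hδ.2).trans hsub)

theorem _root_.Filter.Eventually.closedBall {P : Plane → Prop} (h : ∀ᶠ p in 𝓝 (0 : Plane), P p) :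
    ∀ᶠ δ in 𝓝[>] (0 : ℝ), ∀ p ∈ Metric.closedBall (0 : Plane) δ, P p := by
  obtain ⟨ε, hε, hsub⟩ := Metric.nhds_basis_closedBall.mem_iff.1 h
  filter_upwards [Ioc_mem_nhdsGT hε] with δ hδ p hp
  exact hsub (Metric.closedBall_subset_closedBall hδ.2 hp)

theorem _root_.ContinuousAt.eventually_mem_Icc {f : Plane → ℝ} (hf : ContinuousAt f 0)
    (h0 : 0 < f 0) : ∀ᶠ p in 𝓝 (0 : Plane), f 0 / 2 ≤ f p ∧ f p ≤ 2 * f 0 := by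
  filter_upwards [hf.eventually (lt_mem_nhds (by linarith : f 0 / 2 < f 0)),
    hf.eventually (gt_mem_nhds (by linarith : f 0 < 2 * f 0))] with p h1 h2 using ⟨h1.le, h2.le⟩

variable {Z}

/-- Near the origin an adapted system is given by a global model. The fields are extended from a
small square, on which the slopes are as close to their values at the origin as needed. -/
theorem Adapted.exists_model (hr : 1 ≤ r) {i : Fin 2} {s : ℝ} (h : Z.Adapted i s) :
    ∃ (N : FoldModel) (δ κ : ℝ), Z.Represents i s N δ ∧ 0 < κ ∧
      (-(s * Z.X 0 (otherIdx i)) * (s * Z.Y 0 i) < (s * Z.X 0 i) * (s * Z.Y 0 (otherIdx i)) →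
        N.Steep κ) ∧
      ((s * Z.X 0 i) * (s * Z.Y 0 (otherIdx i)) < -(s * Z.X 0 (otherIdx i)) * (s * Z.Y 0 i) →
        N.Flat κ) := by
  have hs := h.mul_self
  obtain ⟨-, hX1, hX2, hY1, hY2⟩ := h
  set j := otherIdx i with hj
  have hU := Z.isOpen_U.mem_nhds Z.zero_mem_U
  have cX : ∀ k, ContDiffAt ℝ 1 (fun p => s * Z.X p k) 0 := fun k =>
    contDiffAt_const.mul
      (contDiffAt_pi.1 ((Z.contDiffOn_X.contDiffAt hU).of_le hr) k)
  have cY : ∀ k, ContDiffAt ℝ 1 (fun p => s * Z.Y p k) 0 := fun k =>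
    contDiffAt_const.mul
      (contDiffAt_pi.1 ((Z.contDiffOn_Y.contDiffAt hU).of_le hr) k)
  have cFX : ContDiffAt ℝ 1 (fun p => (s * Z.X p j) / (s * Z.X p i)) 0 := (cX j).div (cX i) hX1.ne'
  have cFY : ContDiffAt ℝ 1 (fun p => (s * Z.Y p j) / (s * Z.Y p i)) 0 := (cY j).div (cY i) hY1.ne'
  have hsl : ∀ p, s * Z.slidingField j p =
      ((s * Z.Y p j) * (s * Z.X p i) - (s * Z.X p j) * (s * Z.Y p i)) /
        (s * Z.Y p j - s * Z.X p j) := by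
    intro p
    have hs0 : s ≠ 0 := fun h0 => by simp [h0] at hs
    rw [slidingField, hj, otherIdx_otherIdx, ← mul_sub s, ← mul_div_assoc,
      ← mul_div_mul_left _ _ hs0]
    congr 1
    ring
  have cS : ContDiffAt ℝ 1 (fun p => s * Z.slidingField j p) 0 := by
    simp only [hsl]
    exact (((cY j).mul (cX i)).sub ((cX j).mul (cY i))).div ((cY j).sub (cX j))
      (by linarith : s * Z.Y 0 j - s * Z.X 0 j ≠ 0)
  have hS0 : 0 < s * Z.slidingField j 0 := by
    rw [hsl]
    exact div_pos (by nlinarith [mul_pos hY2 hX1, mul_pos (neg_pos.2 hX2) hY1]) (by linarith)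
  have hFX0 : (s * Z.X 0 j) / (s * Z.X 0 i) < 0 := div_neg_of_neg_of_pos hX2 hX1
  have hFY0 : 0 < (s * Z.Y 0 j) / (s * Z.Y 0 i) := div_pos hY2 hY1
  obtain ⟨K₁, l₁⟩ := (cX i).exists_lipschitzOnWith_closedBall
  obtain ⟨K₂, l₂⟩ := (cY i).exists_lipschitzOnWith_closedBall
  obtain ⟨K₃, l₃⟩ := cFX.exists_lipschitzOnWith_closedBall
  obtain ⟨K₄, l₄⟩ := cFY.exists_lipschitzOnWith_closedBall
  obtain ⟨K₅, l₅⟩ := cS.exists_lipschitzOnWith_closedBall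
  have b₁ := ((cX i).continuousAt.eventually_mem_Icc hX1).closedBall
  have b₂ := ((cY i).continuousAt.eventually_mem_Icc hY1).closedBall
  have b₃ := (cFX.neg.continuousAt.eventually_mem_Icc (neg_pos.2 hFX0)).closedBall
  have b₄ := (cFY.continuousAt.eventually_mem_Icc hFY0).closedBall
  have b₅ := (cS.continuousAt.eventually_mem_Icc hS0).closedBall
  set fX := (s * Z.X 0 j) / (s * Z.X 0 i) with hfX
  set fY := (s * Z.Y 0 j) / (s * Z.Y 0 i) with hfY
  have c₁ : ∀ᶠ δ in 𝓝[>] (0 : ℝ), ∀ p ∈ Metric.closedBall (0 : Plane) δ,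
      (-fX < fY → -((fY - fX) / 2) < (s * Z.X p j) / (s * Z.X p i) ∧
        (fY - fX) / 2 < (s * Z.Y p j) / (s * Z.Y p i)) := by
    refine Eventually.closedBall ?_
    by_cases hc : -fX < fY
    · filter_upwards [cFX.continuousAt.eventually
          (lt_mem_nhds (by show -((fY - fX) / 2) < fX; linarith)),
        cFY.continuousAt.eventually
          (lt_mem_nhds (by show (fY - fX) / 2 < fY; linarith))] with p h1 h2 _ using ⟨h1, h2⟩
    · exact Eventually.of_forall fun p hp => absurd hp hc
  have c₂ : ∀ᶠ δ in 𝓝[>] (0 : ℝ), ∀ p ∈ Metric.closedBall (0 : Plane) δ,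
      (fY < -fX → (s * Z.X p j) / (s * Z.X p i) < -((fY - fX) / 2) ∧
        (s * Z.Y p j) / (s * Z.Y p i) < (fY - fX) / 2) := by
    refine Eventually.closedBall ?_
    by_cases hc : fY < -fX
    · filter_upwards [cFX.continuousAt.eventually
          (gt_mem_nhds (by show fX < -((fY - fX) / 2); linarith)),
        cFY.continuousAt.eventually
          (gt_mem_nhds (by show fY < (fY - fX) / 2; linarith))] with p h1 h2 _ using ⟨h1, h2⟩
    · exact Eventually.of_forall fun p hp => absurd hp hc
  have hUball := Eventually.closedBall (P := fun p => p ∈ Z.U) hU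
  obtain ⟨δ, ⟨⟨⟨⟨⟨⟨l₁, l₂⟩, l₃⟩, l₄⟩, l₅⟩, ⟨⟨⟨⟨b₁, b₂⟩, b₃⟩, b₄⟩, b₅⟩⟩, ⟨⟨c₁, c₂⟩, hUball⟩⟩, hδ⟩ :=
    ((((((l₁.and l₂).and l₃).and l₄).and l₅).and ((((b₁.and b₂).and b₃).and b₄).and b₅)).and
      ((c₁.and c₂).and hUball) |>.and (self_mem_nhdsWithin (s := Ioi (0 : ℝ)))).exists
  have hδ : 0 < δ := hδ
  have hl : 0 < min (-fX) fY / 4 := by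
    have := lt_min (neg_pos.2 hFX0) hFY0
    linarith
  let N : FoldModel :=
    { FX := clampSlope i hs hδ.le l₃ (M := Real.toNNReal (2 * -fX)) fun p hp => by
        rw [Real.coe_toNNReal _ (by linarith), abs_le]
        have := b₃ p hp
        constructor <;> linarith [this.1, this.2]
      FY := clampSlope i hs hδ.le l₄ (M := Real.toNNReal (2 * fY)) fun p hp => by
        rw [Real.coe_toNNReal _ (by linarith), abs_le]
        have := b₄ p hp
        constructor <;> linarith [this.1, this.2]
      vX := clampSpeed i hs hδ.le l₁ (half_pos hX1) b₁
      vY := clampSpeed i hs hδ.le l₂ (half_pos hY1) b₂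
      S := clampSpeed i hs hδ.le l₅ (half_pos hS0) b₅
      l := min (-fX) fY / 4
      l_pos := hl
      FX_lt := fun x y => by
        have := (b₃ _ (clampCoord_mem (i := i) hs hδ.le (x, y))).1
        have h1 := min_le_left (-fX) fY
        show (s * Z.X (clampCoord i hs δ (x, y)) j) / (s * Z.X (clampCoord i hs δ (x, y)) i) <
          -(min (-fX) fY / 4)
        linarith
      lt_FY := fun x y => by
        have := (b₄ _ (clampCoord_mem (i := i) hs hδ.le (x, y))).1
        have h1 := min_le_right (-fX) fY
        show min (-fX) fY / 4 <
          (s * Z.Y (clampCoord i hs δ (x, y)) j) / (s * Z.Y (clampCoord i hs δ (x, y)) i)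
        linarith }
  have hcl : ∀ p ∈ Metric.ball (0 : Plane) δ, clampCoord i hs δ (s * p i, s * p j) = p :=
    fun p hp => clampCoord_signedCoord hs (Metric.ball_subset_closedBall hp)
  have hne₁ : ∀ p ∈ Metric.ball (0 : Plane) δ, s * Z.X p i ≠ 0 := fun p hp => by
    have := (b₁ p (Metric.ball_subset_closedBall hp)).1
    exact (by linarith : 0 < s * Z.X p i).ne'
  have hne₂ : ∀ p ∈ Metric.ball (0 : Plane) δ, s * Z.Y p i ≠ 0 := fun p hp => by
    have := (b₂ p (Metric.ball_subset_closedBall hp)).1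
    exact (by linarith : 0 < s * Z.Y p i).ne'
  refine ⟨N, δ, (fY - fX) / 2, ⟨hs, hδ,
    fun p hp => hUball p (Metric.ball_subset_closedBall hp), fun p hp => ?_, fun p hp => ?_,
    fun p hp => ?_, fun p hp => ?_, fun p hp => ?_⟩, by linarith, fun hc x y => ?_,
    fun hc x y => ?_⟩
  · show _ = s * Z.X (clampCoord i hs δ _) i
    rw [hcl p hp]
  · show _ = (s * Z.X (clampCoord i hs δ _) i) *
      ((s * Z.X (clampCoord i hs δ _) j) / (s * Z.X (clampCoord i hs δ _) i))
    rw [hcl p hp, mul_div_cancel₀ _ (hne₁ p hp)]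
  · show _ = s * Z.Y (clampCoord i hs δ _) i
    rw [hcl p hp]
  · show _ = (s * Z.Y (clampCoord i hs δ _) i) *
      ((s * Z.Y (clampCoord i hs δ _) j) / (s * Z.Y (clampCoord i hs δ _) i))
    rw [hcl p hp, mul_div_cancel₀ _ (hne₂ p hp)]
  · show _ = s * Z.slidingField j (clampCoord i hs δ _)
    rw [hcl p hp]
  · refine c₁ _ (clampCoord_mem hs hδ.le (x, y)) ?_
    rw [hfX, hfY, ← neg_div, div_lt_div_iff₀ hX1 hY1]
    linarith
  · refine c₂ _ (clampCoord_mem hs hδ.le (x, y)) ?_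
    rw [hfX, hfY, ← neg_div, div_lt_div_iff₀ hY1 hX1]
    linarith

end PWSystem

/-! ### Orientation -/

/-- A continuous map that preserves the signs of both coordinates turns no vector by a right angle
or more, so that it preserves the orientation. -/
theorem orientationPreservingAt_of_sign {h : Plane → Plane} (hc : Continuous h)
    (hp : ∀ p k, 0 < h p k ↔ 0 < p k) (hn : ∀ p k, h p k < 0 ↔ p k < 0) :
    OrientationPreservingAt h 0 := by
  have h0 : h 0 = 0 := by
    ext k
    have h1 := hp 0 k
    have h2 := hn 0 k
    simp only [Pi.zero_apply, lt_irrefl, iff_false, not_lt] at h1 h2 ⊢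
    exact le_antisymm h1 h2
  have hmul : ∀ p k, 0 ≤ h p k * p k ∧ (p k ≠ 0 → 0 < h p k * p k) := by
    intro p k
    rcases lt_trichotomy (p k) 0 with h1 | h1 | h1
    · have := mul_pos_of_neg_of_neg ((hn p k).2 h1) h1
      exact ⟨this.le, fun _ => this⟩
    · simp [h1]
    · have := mul_pos ((hp p k).2 h1) h1
      exact ⟨this.le, fun _ => this⟩
  filter_upwards [self_mem_nhdsWithin] with ρ hρ
  have hρ : 0 < ρ := hρ
  let q : ℝ → Plane := fun t => h (0 + ρ • ![Real.cos t, Real.sin t])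
  have hq : Continuous q := hc.comp (by fun_prop)
  -- the quotient of `h p` by `p / ρ`, as complex numbers
  let z : ℝ → ℂ := fun t => ⟨q t 0 * Real.cos t + q t 1 * Real.sin t,
    q t 1 * Real.cos t - q t 0 * Real.sin t⟩
  have hz : Continuous z := by
    refine Complex.equivRealProdCLM.symm.continuous.comp
      (g := Complex.equivRealProdCLM.symm) (f := fun t => (q t 0 * Real.cos t + q t 1 * Real.sin t,
        q t 1 * Real.cos t - q t 0 * Real.sin t)) ?_
    have h0 : Continuous fun t => q t 0 := (continuous_apply 0).comp hq
    have h1 : Continuous fun t => q t 1 := (continuous_apply 1).comp hq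
    fun_prop
  have hre : ∀ t, 0 < (z t).re := by
    intro t
    show 0 < q t 0 * Real.cos t + q t 1 * Real.sin t
    have h1 := hmul (0 + ρ • ![Real.cos t, Real.sin t]) 0
    have h2 := hmul (0 + ρ • ![Real.cos t, Real.sin t]) 1
    have e1 : (0 + ρ • ![Real.cos t, Real.sin t] : Plane) 0 = ρ * Real.cos t := by simp
    have e2 : (0 + ρ • ![Real.cos t, Real.sin t] : Plane) 1 = ρ * Real.sin t := by simp
    rw [e1] at h1
    rw [e2] at h2
    have key : 0 < q t 0 * (ρ * Real.cos t) + q t 1 * (ρ * Real.sin t) := by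
      by_cases hcos : Real.cos t = 0
      · have hsin : Real.sin t ≠ 0 := fun hsin => by
          have := Real.sin_sq_add_cos_sq t
          simp [hcos, hsin] at this
        exact add_pos_of_nonneg_of_pos h1.1 (h2.2 (mul_ne_zero hρ.ne' hsin))
      · exact add_pos_of_pos_of_nonneg (h1.2 (mul_ne_zero hρ.ne' hcos)) h2.1
    have : 0 < ρ * (q t 0 * Real.cos t + q t 1 * Real.sin t) := by linarith
    exact pos_of_mul_pos_right this hρ.le
  have hz0 : z (2 * Real.pi) = z 0 := by simp [z, q]
  refine ⟨fun t => t + (z t).arg, fun t => ‖z t‖, ?_, ?_, fun t _ => ⟨?_, ?_⟩⟩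
  · refine Continuous.continuousOn (continuous_id.add (continuous_iff_continuousAt.2 fun t => ?_))
    exact (Complex.continuousAt_arg (Or.inl (hre t))).comp hz.continuousAt
  · simp only [hz0]; ring
  · exact norm_pos_iff.2 fun h1 => by simpa [h1] using hre t
  · have hcos : ‖z t‖ * Real.cos (z t).arg = (z t).re := Complex.norm_mul_cos_arg _
    have hsin : ‖z t‖ * Real.sin (z t).arg = (z t).im := Complex.norm_mul_sin_arg _
    have hre' : (z t).re = q t 0 * Real.cos t + q t 1 * Real.sin t := rfl
    have him' : (z t).im = q t 1 * Real.cos t - q t 0 * Real.sin t := rfl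
    have h1 := Real.sin_sq_add_cos_sq t
    show q t - h 0 = _
    rw [h0, sub_zero]
    ext k
    fin_cases k
    · show q t 0 = ‖z t‖ * Real.cos (t + (z t).arg)
      rw [Real.cos_add]
      linear_combination -(q t 0) * h1 + Real.sin t * (hsin.trans him') -
        Real.cos t * (hcos.trans hre')
    · show q t 1 = ‖z t‖ * Real.sin (t + (z t).arg)
      rw [Real.sin_add]
      linear_combination -(q t 1) * h1 - Real.sin t * (hcos.trans hre') -
        Real.cos t * (hsin.trans him')

/-! ### Trajectories in the local model -/

namespace PWSystem

variable {r : WithTop ℕ∞}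

section sign

variable {i : Fin 2} {s : ℝ}

theorem mul_mul_mul_of_mul_self (hs : s * s = 1) (a b : ℝ) : (s * a) * (s * b) = a * b := by
  linear_combination a * b * hs

theorem mul_eq_zero_iff_of_mul_self (hs : s * s = 1) {a : ℝ} : s * a = 0 ↔ a = 0 := by
  have : s ≠ 0 := fun h => by simp [h] at hs
  simp [this]

theorem hasDerivAt_mul_iff (hs : s * s = 1) {f : ℝ → ℝ} {v t : ℝ} :
    HasDerivAt (fun u => s * f u) (s * v) t ↔ HasDerivAt f v t := by
  refine ⟨fun h => ?_, fun h => h.const_mul s⟩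
  have := h.const_mul s
  simpa only [← mul_assoc, hs, one_mul] using this

theorem hasDerivAt_plane_iff (hs : s * s = 1) {γ : ℝ → Plane} {v : Plane} {t : ℝ} :
    HasDerivAt γ v t ↔ HasDerivAt (fun u => s * γ u i) (s * v i) t ∧
      HasDerivAt (fun u => s * γ u (otherIdx i)) (s * v (otherIdx i)) t := by
  rw [hasDerivAt_mul_iff hs, hasDerivAt_mul_iff hs, hasDerivAt_pi]
  refine ⟨fun h => ⟨h _, h _⟩, fun h k => ?_⟩
  rcases eq_or_eq_otherIdx i k with rfl | rfl
  · exact h.1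
  · exact h.2

end sign

namespace Represents

variable {Z : PWSystem r} {i : Fin 2} {s : ℝ} {N : FoldModel} {δ : ℝ}
  (R : Z.Represents i s N δ)

include R

theorem X_mul_Y_pos {p : Plane} (hp : p ∈ Metric.ball (0 : Plane) δ) : 0 < Z.X p i * Z.Y p i := by
  rw [← mul_mul_mul_of_mul_self R.mul_self, R.X_fst p hp, R.Y_fst p hp]
  exact mul_pos (N.vX.pos _) (N.vY.pos _)

theorem X_mul_Y_neg {p : Plane} (hp : p ∈ Metric.ball (0 : Plane) δ) :
    Z.X p (otherIdx i) * Z.Y p (otherIdx i) < 0 := by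
  rw [← mul_mul_mul_of_mul_self R.mul_self, R.X_snd p hp, R.Y_snd p hp]
  exact mul_neg_of_neg_of_pos
    (mul_neg_of_pos_of_neg (N.vX.pos _) ((N.FX_lt _ _).trans (neg_neg_of_pos N.l_pos)))
    (mul_pos (N.vY.pos _) (N.l_pos.trans (N.lt_FY _ _)))

theorem mem_crossing_iff {p : Plane} (hp : p ∈ Metric.ball (0 : Plane) δ) (k : Fin 2) :
    p ∈ Z.crossing k ↔ k = i ∧ p i = 0 := by
  rcases eq_or_eq_otherIdx i k with rfl | rfl
  · exact ⟨fun h => ⟨rfl, h.1.2⟩, fun h => ⟨⟨R.ball_subset hp, h.2⟩, R.X_mul_Y_pos hp⟩⟩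
  · exact ⟨fun h => absurd h.2 (R.X_mul_Y_neg hp).not_gt, fun h => absurd h.1 (otherIdx_ne i)⟩

theorem mem_slideEscape_iff {p : Plane} (hp : p ∈ Metric.ball (0 : Plane) δ) (k : Fin 2) :
    p ∈ Z.slideEscape k ↔ k = otherIdx i ∧ p (otherIdx i) = 0 ∧ p i ≠ 0 := by
  constructor
  · intro h
    have hb : p ∈ Z.branch k := h.elim And.left And.left
    have hneg : Z.X p k * Z.Y p k < 0 := by
      rcases h with ⟨-, ⟨-, h1, h2⟩ | ⟨-, h1, h2⟩⟩ | ⟨-, ⟨-, h1, h2⟩ | ⟨-, h1, h2⟩⟩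
      · exact mul_neg_of_neg_of_pos h1 h2
      · exact mul_neg_of_pos_of_neg h1 h2
      · exact mul_neg_of_pos_of_neg h1 h2
      · exact mul_neg_of_neg_of_pos h1 h2
    have hne : p (otherIdx k) ≠ 0 := by
      rcases h with ⟨-, ⟨h1, -⟩ | ⟨h1, -⟩⟩ | ⟨-, ⟨h1, -⟩ | ⟨h1, -⟩⟩
      · exact h1.ne'
      · exact h1.ne
      · exact h1.ne'
      · exact h1.ne
    rcases eq_or_eq_otherIdx i k with rfl | rfl
    · exact absurd hneg (R.X_mul_Y_pos hp).not_gt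
    · rw [otherIdx_otherIdx] at hne
      exact ⟨rfl, hb.2, hne⟩
  · rintro ⟨rfl, h0, hne⟩
    have hb : p ∈ Z.branch (otherIdx i) := ⟨R.ball_subset hp, h0⟩
    have hne : p (otherIdx (otherIdx i)) ≠ 0 := by rwa [otherIdx_otherIdx]
    rcases mul_neg_iff.1 (R.X_mul_Y_neg hp) with ⟨h1, h2⟩ | ⟨h1, h2⟩ <;>
      rcases hne.lt_or_gt with h3 | h3
    · exact Or.inl ⟨hb, Or.inr ⟨h3, h1, h2⟩⟩
    · exact Or.inr ⟨hb, Or.inl ⟨h3, h1, h2⟩⟩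
    · exact Or.inr ⟨hb, Or.inr ⟨h3, h1, h2⟩⟩
    · exact Or.inl ⟨hb, Or.inl ⟨h3, h1, h2⟩⟩

theorem zero_mem_ball : (0 : Plane) ∈ Metric.ball (0 : Plane) δ := Metric.mem_ball_self R.pos

/-- Points of the first axis arbitrarily close to the origin. -/
theorem frequently_axis : ∃ᶠ p in 𝓝 (0 : Plane), p (otherIdx i) = 0 ∧ p i ≠ 0 := by
  have hc : Tendsto (fun x : ℝ => (signedCoord i R.mul_self).symm (x, 0)) (𝓝[≠] 0)
      (𝓝 (0 : Plane)) := by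
    have h1 : Continuous fun x : ℝ => (signedCoord i R.mul_self).symm (x, 0) :=
      (signedCoord i R.mul_self).symm.continuous.comp (by fun_prop)
    have h2 : (signedCoord i R.mul_self).symm ((0 : ℝ), (0 : ℝ)) = 0 := by
      rw [Homeomorph.symm_apply_eq, signedCoord_apply]
      simp
    exact (h2 ▸ h1.tendsto 0).mono_left nhdsWithin_le_nhds
  refine hc.frequently (Eventually.frequently ?_)
  filter_upwards [self_mem_nhdsWithin] with x hx
  rw [signedCoord_symm_other, signedCoord_symm_self, mul_zero, Ne,
    mul_eq_zero_iff_of_mul_self R.mul_self]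
  exact ⟨rfl, hx⟩

theorem not_originCrossing : ¬ Z.OriginCrossing := by
  intro h
  obtain ⟨p, ⟨h0, hne⟩, hp, hcl⟩ :=
    (R.frequently_axis.and_eventually ((Metric.isOpen_ball.eventually_mem R.zero_mem_ball).and h)).exists
  have hcl := hcl ⟨R.ball_subset hp, by rw [mul_otherIdx p i, h0, mul_zero]⟩
  have hev : ∀ᶠ q in 𝓝 p, q i ≠ 0 := (continuous_apply i).continuousAt.eventually_ne hne
  obtain ⟨q, hq, hqi, hqb⟩ :=
    ((mem_closure_iff_frequently.1 hcl).and_eventually (hev.and (Metric.isOpen_ball.eventually_mem hp))).exists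
  rcases hq with hq | hq <;> exact hqi ((R.mem_crossing_iff hqb _).1 hq).2

theorem zero_mem_closure_slideEscape_iff (k : Fin 2) :
    (0 : Plane) ∈ closure (Z.slideEscape k) ↔ k = otherIdx i := by
  constructor
  · intro h
    obtain ⟨q, hq, hqb⟩ := ((mem_closure_iff_frequently.1 h).and_eventually
      (Metric.isOpen_ball.eventually_mem R.zero_mem_ball)).exists
    exact ((R.mem_slideEscape_iff hqb _).1 hq).1
  · rintro rfl
    rw [mem_closure_iff_frequently]
    refine (R.frequently_axis.and_eventually (Metric.isOpen_ball.eventually_mem R.zero_mem_ball)).mono ?_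
    exact fun p hp => (R.mem_slideEscape_iff hp.2 _).2 ⟨rfl, hp.1⟩

theorem not_originDoubleSliding : ¬ Z.OriginDoubleSliding := fun h =>
  otherIdx_ne i ((R.zero_mem_closure_slideEscape_iff i).1 (h i)).symm

theorem originSliding_iff (k : Fin 2) : Z.OriginSliding k ↔ k = otherIdx i := by
  refine ⟨fun h => (R.zero_mem_closure_slideEscape_iff k).1 h.1, fun h =>
    ⟨(R.zero_mem_closure_slideEscape_iff k).2 h, subset_closure ?_⟩⟩
  rw [h, otherIdx_otherIdx]
  exact (R.mem_crossing_iff R.zero_mem_ball i).2 ⟨rfl, rfl⟩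

theorem originAt_iff {I : Set ℝ} {γ : ℝ → Plane} {t : ℝ} :
    Z.OriginAt I γ t ↔ γ t = 0 ∧ Z.SlidesAt (otherIdx i) γ t := by
  refine and_congr_right fun _ => ⟨?_, fun h => Or.inr (Or.inl
    ⟨R.not_originCrossing, R.not_originDoubleSliding, _, (R.originSliding_iff _).2 rfl, h⟩)⟩
  rintro (⟨h, -⟩ | ⟨-, -, k, hk, h⟩ | ⟨-, h | h, -⟩)
  · exact absurd h R.not_originCrossing
  · rwa [(R.originSliding_iff k).1 hk] at h
  · exact absurd h R.not_originDoubleSliding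
  · exact absurd ((R.originSliding_iff _).2 rfl) (h (otherIdx i))

theorem slidesAt_iff {γ : ℝ → Plane} {t : ℝ} (hγ : ∀ᶠ u in 𝓝 t, γ u ∈ Metric.ball (0 : Plane) δ) :
    Z.SlidesAt (otherIdx i) γ t ↔ (∀ᶠ u in 𝓝 t, s * γ u (otherIdx i) = 0) ∧
      HasDerivAt (fun u => s * γ u i) (N.S (s * γ t i, 0)) t := by
  have h1 : (∀ᶠ u in 𝓝 t, γ u ∈ Z.branch (otherIdx i)) ↔
      ∀ᶠ u in 𝓝 t, s * γ u (otherIdx i) = 0 := by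
    refine eventually_congr ?_
    filter_upwards [hγ] with u hu
    rw [mul_eq_zero_iff_of_mul_self R.mul_self]
    exact ⟨fun h => h.2, fun h => ⟨R.ball_subset hu, h⟩⟩
  unfold SlidesAt
  rw [h1, otherIdx_otherIdx]
  refine and_congr_right fun h => ?_
  have h2 := R.sliding _ hγ.self_of_nhds
  rw [h.self_of_nhds] at h2
  rw [← h2, hasDerivAt_mul_iff R.mul_self]

/-- In the ball there are no tangency points, and the rule at the origin is the one of the sliding
vector field. -/
theorem obeys_iff {I : Set ℝ} {γ : ℝ → Plane} {t : ℝ}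
    (hγ : ∀ᶠ u in 𝓝 t, γ u ∈ Metric.ball (0 : Plane) δ) :
    (Z.RegularAt γ t ∨ Z.TangentAt I γ t ∨ Z.OriginAt I γ t) ↔
      N.Obeys (fun u => s * γ u i) (fun u => s * γ u (otherIdx i)) t := by
  have hs := R.mul_self
  have hb := hγ.self_of_nhds
  have hmul : ∀ u, (s * γ u i) * (s * γ u (otherIdx i)) = γ u 0 * γ u 1 := fun u => by
    rw [mul_mul_mul_of_mul_self hs, mul_otherIdx _ i]
  have hpos : ∀ {l : Filter ℝ}, l ≤ 𝓝 t →
      ((∀ᶠ u in l, γ u ∈ Z.Upos) ↔ ∀ᶠ u in l, 0 < (s * γ u i) * (s * γ u (otherIdx i))) :=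
    fun hl => eventually_congr <| (hγ.filter_mono hl).mono fun u hu => by
      rw [hmul]; exact ⟨fun h => h.2, fun h => ⟨R.ball_subset hu, h⟩⟩
  have hneg : ∀ {l : Filter ℝ}, l ≤ 𝓝 t →
      ((∀ᶠ u in l, γ u ∈ Z.Uneg) ↔ ∀ᶠ u in l, (s * γ u i) * (s * γ u (otherIdx i)) < 0) :=
    fun hl => eventually_congr <| (hγ.filter_mono hl).mono fun u hu => by
      rw [hmul]; exact ⟨fun h => h.2, fun h => ⟨R.ball_subset hu, h⟩⟩
  unfold RegularAt FoldModel.Obeys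
  simp only [← hpos nhdsWithin_le_nhds, ← hneg nhdsWithin_le_nhds]
  rw [R.originAt_iff, R.slidesAt_iff hγ]
  simp only [hmul, mul_eq_zero_iff_of_mul_self hs, Ne]
  rw [← R.X_snd _ hb, ← R.X_fst _ hb, ← R.Y_snd _ hb, ← R.Y_fst _ hb,
    ← hasDerivAt_plane_iff hs, ← hasDerivAt_plane_iff hs]
  constructor
  · rintro ((⟨h1, h2⟩ | ⟨h1, h2⟩ | ⟨k, h1, h2, h3⟩ | ⟨k, h1, h2⟩) | ⟨k, ⟨-, -, h1⟩, -⟩ | ⟨h1, h2⟩)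
    · exact Or.inl ⟨h1.2, h2⟩
    · exact Or.inr (Or.inl ⟨h1.2, h2⟩)
    · have h4 := ((R.mem_crossing_iff hb k).1 h1).2
      refine Or.inr (Or.inr (Or.inl ⟨h4, fun h5 => h2 ?_, h3⟩))
      ext k
      rcases eq_or_eq_otherIdx i k with rfl | rfl
      · exact h4
      · exact h5
    · obtain ⟨rfl, h3, -⟩ := (R.mem_slideEscape_iff hb k).1 h1
      rw [R.slidesAt_iff hγ] at h2
      simp only [mul_eq_zero_iff_of_mul_self hs] at h2
      exact Or.inr (Or.inr (Or.inr ⟨h3, h2⟩))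
    · rcases eq_or_eq_otherIdx i k with rfl | rfl
      · exact absurd h1 (R.X_mul_Y_pos hb).ne'
      · exact absurd h1 (R.X_mul_Y_neg hb).ne
    · exact Or.inr (Or.inr (Or.inr ⟨by rw [h1]; rfl, h2⟩))
  · rintro (⟨h1, h2⟩ | ⟨h1, h2⟩ | ⟨h1, h2, h3⟩ | ⟨h1, h2⟩)
    · exact Or.inl (Or.inl ⟨⟨R.ball_subset hb, h1⟩, h2⟩)
    · exact Or.inl (Or.inr (Or.inl ⟨⟨R.ball_subset hb, h1⟩, h2⟩))
    · refine Or.inl (Or.inr (Or.inr (Or.inl ⟨i, (R.mem_crossing_iff hb i).2 ⟨rfl, h1⟩,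
        fun h4 => h2 (by rw [h4]; rfl), h3⟩)))
    · by_cases h3 : γ t i = 0
      · refine Or.inr (Or.inr ⟨?_, h2⟩)
        ext k
        rcases eq_or_eq_otherIdx i k with rfl | rfl
        · exact h3
        · exact h1
      · refine Or.inl (Or.inr (Or.inr (Or.inr ⟨otherIdx i,
          (R.mem_slideEscape_iff hb _).2 ⟨rfl, h1, h3⟩, ?_⟩)))
        rw [R.slidesAt_iff hγ]
        simpa only [mul_eq_zero_iff_of_mul_self hs] using h2

theorem isTrajectory_iff_traj {V : Set Plane} {I : Set ℝ} {γ : ℝ → Plane}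
    (hV : V ⊆ Metric.ball (0 : Plane) δ) :
    Z.IsTrajectory V I γ ↔ (∀ t ∈ I, γ t ∈ V) ∧
      N.Traj I (fun u => s * γ u i) (fun u => s * γ u (otherIdx i)) := by
  have hs := R.mul_self
  have hcoord : ∀ u, signedCoord i hs (γ u) = (s * γ u i, s * γ u (otherIdx i)) := fun u => rfl
  have hev : IsOpen I → (∀ t ∈ I, γ t ∈ V) → ∀ t ∈ I,
      ∀ᶠ u in 𝓝 t, γ u ∈ Metric.ball (0 : Plane) δ := fun ho hγ t ht =>
    (ho.eventually_mem ht).mono fun u hu => hV (hγ u hu)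
  constructor
  · rintro ⟨ho, hI, hne, hc, hm, h⟩
    have hγ : ∀ t ∈ I, γ t ∈ V := fun t ht => (hm t ht).1
    have hk : ∀ k, ContinuousOn (fun u => s * γ u k) I := fun k =>
      continuousOn_const.mul ((continuous_apply k).comp_continuousOn hc)
    exact ⟨hγ, ho, hI, hne, hk _, hk _, fun t ht => (R.obeys_iff (hev ho hγ t ht)).1 (h t ht)⟩
  · rintro ⟨hγ, ho, hI, hne, hx, hy, h⟩
    refine ⟨ho, hI, hne, ?_, fun t ht => ⟨hγ t ht, R.ball_subset (hV (hγ t ht))⟩,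
      fun t ht => (R.obeys_iff (hev ho hγ t ht)).2 (h t ht)⟩
    have := (signedCoord i hs).symm.continuous.comp_continuousOn (hx.prodMk hy)
    refine this.congr fun u _ => ?_
    show γ u = (signedCoord i hs).symm (s * γ u i, s * γ u (otherIdx i))
    rw [← hcoord, Homeomorph.symm_apply_apply]

/-- A map of the models yields a map of the trajectories of the systems. -/
theorem sendsTrajectories {Z' : PWSystem r} {N' : FoldModel} {δ' : ℝ}
    (R' : Z'.Represents i s N' δ') {V V' : Set Plane} (hV : V ⊆ Metric.ball (0 : Plane) δ)
    (hV' : V' ⊆ Metric.ball (0 : Plane) δ') {e : ℝ × ℝ → ℝ × ℝ} (he : N.Sends N' e)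
    {h : Plane → Plane} (hVV : MapsTo h V V')
    (hh : ∀ p, signedCoord i R.mul_self (h p) = e (signedCoord i R.mul_self p)) :
    SendsTrajectories Z Z' V V' h := by
  intro I γ hγ
  obtain ⟨hm, hT⟩ := (R.isTrajectory_iff_traj hV).1 hγ
  obtain ⟨I', x', y', τ, hT', hτ, hτc, rfl, heq⟩ := he _ _ _ hT
  set γ' : ℝ → Plane := fun u => (signedCoord i R.mul_self).symm (x' u, y' u) with hγ'
  have hcoord : ∀ u, (s * γ' u i, s * γ' u (otherIdx i)) = (x' u, y' u) := fun u => by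
    rw [← signedCoord_apply R.mul_self, hγ', Homeomorph.apply_symm_apply]
  have hx : (fun u => s * γ' u i) = x' := funext fun u => congrArg Prod.fst (hcoord u)
  have hy : (fun u => s * γ' u (otherIdx i)) = y' := funext fun u => congrArg Prod.snd (hcoord u)
  have key : ∀ t ∈ I, h (γ t) = γ' (τ t) := fun t ht => by
    rw [hγ', eq_comm, Homeomorph.symm_apply_eq, hh, signedCoord_apply, heq t ht]
  refine ⟨_, γ', τ, (R'.isTrajectory_iff_traj hV').2 ⟨?_, by rwa [hx, hy]⟩, hτ, hτc, rfl, key⟩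
  rintro _ ⟨t, ht, rfl⟩
  rw [← key t ht]
  exact hVV (hm t ht)

end Represents

/-- Systems given near the origin by models on the same side are locally equivalent. -/
theorem Represents.locallySigmaEquivalent {Z Z' : PWSystem r} {i : Fin 2} {s : ℝ}
    {N N' : FoldModel} {δ δ' : ℝ} (R : Z.Represents i s N δ) (R' : Z'.Represents i s N' δ')
    {e : ℝ × ℝ ≃ₜ ℝ × ℝ} {η : ℝ ≃o ℝ} (M : N.Matches N' e η) : LocallySigmaEquivalent Z Z' := by
  have hs := R.mul_self
  set L := signedCoord i hs with hL
  set H : Plane ≃ₜ Plane := L.trans (e.trans L.symm) with hH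
  have hHL : ∀ p, L (H p) = e (L p) := fun p => L.apply_symm_apply _
  have hHL' : ∀ p, L (H.symm p) = e.symm (L p) := fun p => by
    rw [← e.symm_apply_apply (L (H.symm p)), ← hHL, H.apply_symm_apply]
  -- multiplying by `s` twice recovers the signs in the original coordinates
  have hsgn : ∀ {a b : ℝ}, ((0 < s * a ↔ 0 < s * b) ∧ (s * a < 0 ↔ s * b < 0)) →
      ((0 < a ↔ 0 < b) ∧ (a < 0 ↔ b < 0)) := by
    intro a b h
    rcases mul_self_eq_one_iff.1 hs with rfl | rfl
    · simpa using h
    · simpa [and_comm] using h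
  have hfst : ∀ p, s * H p i = η (s * p i) := fun p => by
    have := congrArg Prod.fst (hHL p)
    rwa [M.fst] at this
  have hsnd : ∀ p, s * H p (otherIdx i) = (e (L p)).2 := fun p => congrArg Prod.snd (hHL p)
  have hsign : ∀ p k, (0 < H p k ↔ 0 < p k) ∧ (H p k < 0 ↔ p k < 0) := by
    intro p k
    apply hsgn
    rcases eq_or_eq_otherIdx i k with rfl | rfl
    · rw [hfst]
      exact ⟨OrderIso.pos_of_pos M.zero, OrderIso.neg_of_neg M.zero⟩
    · rw [hsnd]
      exact ⟨M.pos _, M.neg _⟩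
  have hzero : ∀ p k, H p k = 0 ↔ p k = 0 := fun p k => by
    have := hsign p k
    constructor <;> intro h <;> apply le_antisymm <;> rw [← not_lt] <;> grind
  have hH0 : H 0 = 0 := by
    ext k
    exact (hzero 0 k).2 rfl
  obtain ⟨ρ, hρ, hsub⟩ := Metric.mem_nhds_iff.1 <| inter_mem (Metric.ball_mem_nhds (0 : Plane) R.pos)
    (H.continuous.tendsto' 0 0 hH0 (Metric.ball_mem_nhds (0 : Plane) R'.pos))
  have hV' : H '' Metric.ball 0 ρ ⊆ Metric.ball 0 δ' := by
    rintro _ ⟨p, hp, rfl⟩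
    exact (hsub hp).2
  have hV : Metric.ball 0 ρ ⊆ Metric.ball (0 : Plane) δ := fun p hp => (hsub hp).1
  refine ⟨H.toOpenPartialHomeomorphOfImageEq (Metric.ball 0 ρ) Metric.isOpen_ball _ rfl,
    hV.trans R.ball_subset, hV'.trans R'.ball_subset, Metric.mem_ball_self hρ, hH0,
    (convex_ball 0 ρ).isConnected (Metric.nonempty_ball.2 hρ),
    orientationPreservingAt_of_sign H.continuous (fun p k => (hsign p k).1)
      fun p k => (hsign p k).2, ?_, ?_, ?_⟩
  · show H '' (Metric.ball 0 ρ ∩ Z.switching) = H '' Metric.ball 0 ρ ∩ Z'.switching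
    ext q
    constructor
    · rintro ⟨p, ⟨hp, hpS⟩, rfl⟩
      refine ⟨mem_image_of_mem _ hp, R'.ball_subset (hV' (mem_image_of_mem _ hp)), ?_⟩
      rw [mul_eq_zero, hzero, hzero]
      exact mul_eq_zero.1 hpS.2
    · rintro ⟨⟨p, hp, rfl⟩, hpS⟩
      refine ⟨p, ⟨hp, R.ball_subset (hV hp), ?_⟩, rfl⟩
      rw [mul_eq_zero, ← hzero p 0, ← hzero p 1]
      exact mul_eq_zero.1 hpS.2
  · exact R.sendsTrajectories R' hV hV' M.sends (mapsTo_image H _) hHL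
  · refine R'.sendsTrajectories R hV' hV M.symm.sends ?_ hHL'
    rintro _ ⟨p, hp, rfl⟩
    show H.symm (H p) ∈ _
    rwa [H.symm_apply_apply]

end PWSystem

/-! ### The normal form -/

theorem sign_eq_of_mul_pos {s x : ℝ} (hs : s * s = 1) (h : 0 < s * x) : Real.sign x = s := by
  rcases mul_self_eq_one_iff.1 hs with rfl | rfl
  · exact Real.sign_of_pos (by linarith)
  · exact Real.sign_of_neg (by linarith)

theorem sign_eq_of_mul_neg {s x : ℝ} (hs : s * s = 1) (h : s * x < 0) : Real.sign x = -s := by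
  rcases mul_self_eq_one_iff.1 hs with rfl | rfl
  · exact Real.sign_of_neg (by linarith)
  · rw [neg_neg]; exact Real.sign_of_pos (by linarith)

theorem kronecker_self (x : ℝ) : kronecker x x = 1 := if_pos rfl

theorem kronecker_of_ne {x y : ℝ} (h : x ≠ y) : kronecker x y = 0 := if_neg h

theorem kronecker_nonneg (x y : ℝ) : 0 ≤ kronecker x y := by
  unfold kronecker
  split_ifs <;> norm_num

namespace PWSystem

variable {r : WithTop ℕ∞} {Z : PWSystem r}

theorem Omega32.exists_adapted (h : Z.Omega32) : ∃ i s, Z.Adapted i s := by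
  obtain ⟨⟨i, h1, h2⟩, h3, -⟩ := h
  have hX : Z.X 0 i ≠ 0 := fun h0 => by simp [h0] at h1
  obtain ⟨s, hs, hp⟩ : ∃ s : ℝ, s * s = 1 ∧ 0 < s * Z.X 0 i := by
    rcases hX.lt_or_gt with h0 | h0
    · exact ⟨-1, by norm_num, by linarith⟩
    · exact ⟨1, by norm_num, by linarith⟩
  rw [mul_otherIdx _ i, ← mul_mul_mul_of_mul_self hs] at h3
  rw [← mul_mul_mul_of_mul_self hs] at h1 h2
  have hn := neg_of_mul_neg_right h3 hp.le
  exact ⟨i, s, hs, hp, hn, pos_of_mul_pos_right h1 hp.le, pos_of_mul_neg_right h2 hn.le⟩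

/-- The normal form is adapted to the same coordinates as `Z`, and the comparison of the slopes of
`X` and `Y` at the origin, which is the sign of `α_Z + 1`, has the same outcome for both. -/
theorem Adapted.normalForm {i : Fin 2} {s : ℝ} (h : Z.Adapted i s) (hα : Z.alpha ≠ -1) :
    (normalForm Z).Adapted i s ∧
    ((-(s * Z.X 0 (otherIdx i)) * (s * Z.Y 0 i) < (s * Z.X 0 i) * (s * Z.Y 0 (otherIdx i)) ∧
      -(s * (_root_.normalForm Z).X 0 (otherIdx i)) * (s * (_root_.normalForm Z).Y 0 i) <
        (s * (_root_.normalForm Z).X 0 i) * (s * (_root_.normalForm Z).Y 0 (otherIdx i))) ∨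
    ((s * Z.X 0 i) * (s * Z.Y 0 (otherIdx i)) < -(s * Z.X 0 (otherIdx i)) * (s * Z.Y 0 i) ∧
      (s * (_root_.normalForm Z).X 0 i) * (s * (_root_.normalForm Z).Y 0 (otherIdx i)) <
        -(s * (_root_.normalForm Z).X 0 (otherIdx i)) * (s * (_root_.normalForm Z).Y 0 i))) := by
  obtain ⟨hs, hX1, hX2, hY1, hY2⟩ := h
  set d₁ := kronecker 1 (Real.sign (Z.alpha + 1)) with hd₁
  set d₂ := kronecker (-1) (Real.sign (Z.alpha + 1)) with hd₂
  have n₁ : 0 ≤ d₁ := kronecker_nonneg _ _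
  have n₂ : 0 ≤ d₂ := kronecker_nonneg _ _
  have hα' : Z.alpha + 1 ≠ 0 := fun h0 => hα (by linarith)
  have hc : (0 < Z.alpha + 1 ∧ d₁ = 1 ∧ d₂ = 0) ∨ (Z.alpha + 1 < 0 ∧ d₁ = 0 ∧ d₂ = 1) := by
    rcases hα'.lt_or_gt with h0 | h0
    · right
      rw [hd₁, hd₂, Real.sign_of_neg h0]
      exact ⟨h0, kronecker_of_ne (by norm_num), kronecker_self _⟩
    · left
      rw [hd₁, hd₂, Real.sign_of_pos h0]
      exact ⟨h0, kronecker_self _, kronecker_of_ne (by norm_num)⟩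
  have hX0 : (_root_.normalForm Z).X 0 0 = Real.sign (Z.X 0 0) := rfl
  have hX1' : (_root_.normalForm Z).X 0 1 = -Real.sign (Z.X 0 0) := rfl
  have hY0 : (_root_.normalForm Z).Y 0 0 = Real.sign (Z.Y 0 0) * (1 + d₁) := rfl
  have hY1' : (_root_.normalForm Z).Y 0 1 = Real.sign (Z.Y 0 0) * (1 + d₂) := rfl
  have hsα : (Z.alpha + 1) * ((s * Z.X 0 1) * (s * Z.Y 0 0)) =
      (s * Z.X 0 0) * (s * Z.Y 0 1) + (s * Z.X 0 1) * (s * Z.Y 0 0) := by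
    simp only [mul_mul_mul_of_mul_self hs]
    have hne : Z.X 0 1 * Z.Y 0 0 ≠ 0 := by
      rw [← mul_mul_mul_of_mul_self hs]
      fin_cases i
      · exact (mul_neg_of_neg_of_pos hX2 hY1).ne
      · exact (mul_pos hX1 hY2).ne'
    rw [alpha, add_mul, one_mul, div_mul_cancel₀ _ hne]
  fin_cases i
  · simp only [otherIdx, Fin.zero_eta, Fin.isValue, sub_zero] at *
    have eX := sign_eq_of_mul_pos hs hX1
    have eY := sign_eq_of_mul_pos hs hY1
    rw [hX0, hX1', hY0, hY1', eX, eY]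
    have e : ∀ d : ℝ, s * (s * (1 + d)) = 1 + d := fun d => by rw [← mul_assoc, hs, one_mul]
    have hneg := mul_neg_of_neg_of_pos hX2 hY1
    rw [mul_neg, hs, e, e]
    refine ⟨⟨hs, ?_, ?_, ?_, ?_⟩, ?_⟩
    · rw [hX0, eX, hs]; exact one_pos
    · show s * (_root_.normalForm Z).X 0 1 < 0
      rw [hX1', eX, mul_neg, hs]; norm_num
    · rw [hY0, eY, e]; linarith
    · show 0 < s * (_root_.normalForm Z).Y 0 1
      rw [hY1', eY, e]; linarith
    · rcases hc with ⟨h0, h1, h2⟩ | ⟨h0, h1, h2⟩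
      · right
        rw [h1, h2]
        have := mul_neg_of_pos_of_neg h0 hneg
        constructor <;> linarith
      · left
        rw [h1, h2]
        have := mul_pos_of_neg_of_neg h0 hneg
        constructor <;> linarith
  · simp only [otherIdx, Fin.mk_one, Fin.isValue, sub_self] at *
    have eX := sign_eq_of_mul_neg hs hX2
    have eY := sign_eq_of_mul_pos hs hY2
    rw [hX0, hX1', hY0, hY1', eX, eY]
    have e : ∀ d : ℝ, s * (s * (1 + d)) = 1 + d := fun d => by rw [← mul_assoc, hs, one_mul]
    have hpos := mul_pos hX1 hY2
    rw [neg_neg, mul_neg, hs, e, e]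
    refine ⟨⟨hs, ?_, ?_, ?_, ?_⟩, ?_⟩
    · rw [hX1', eX, neg_neg, hs]; exact one_pos
    · show s * (_root_.normalForm Z).X 0 0 < 0
      rw [hX0, eX, mul_neg, hs]; norm_num
    · rw [hY1', eY, e]; linarith
    · show 0 < s * (_root_.normalForm Z).Y 0 0
      rw [hY0, eY, e]; linarith
    · rcases hc with ⟨h0, h1, h2⟩ | ⟨h0, h1, h2⟩
      · left
        rw [h1, h2]
        have := mul_pos h0 hpos
        constructor <;> linarith
      · right
        rw [h1, h2]
        have := mul_neg_of_neg_of_pos h0 hpos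
        constructor <;> linarith

end PWSystem

theorem mainTheorem7 {r : WithTop ℕ∞} (hr : 1 ≤ r) (Z : PWSystem r) (hZ : Z.Omega32) :
    LocallySigmaEquivalent Z (normalForm Z) := by
  obtain ⟨i, s, hA⟩ := hZ.exists_adapted
  obtain ⟨hA', hside⟩ := hA.normalForm hZ.2.2
  obtain ⟨N, δ, κ, R, hκ, hsteep, hflat⟩ := hA.exists_model hr
  obtain ⟨N', δ', κ', R', hκ', hsteep', hflat'⟩ := hA'.exists_model hr
  obtain ⟨e, η, M⟩ := N.exists_matches N' hκ hκ'
    (hside.imp (fun h => ⟨hsteep h.1, hsteep' h.2⟩) fun h => ⟨hflat h.1, hflat' h.2⟩)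
  exact R.locallySigmaEquivalent R' M
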